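/- Let $I\subseteq\mathbb R$ be a nondegenerate interval with interior $I^\circ$, and let $\Theta$ be the Heaviside function with $\Theta(0)=1$. A generalized function $G(t',t)$ acts on test functions by $\varphi\mapsto\int G(t',t)\varphi(t)\,dt$. In particular $\delta^{(j)}=\delta^{(j)}(t'-t)$ sends $\varphi$ to $\varphi^{(j)}(t')$. The product is $(F*G)(t',t)=\int F(t',\tau)G(\tau,t)\,d\tau$, with unit $\delta$. Write $u^{(i,j)}$ for $\partial_{t'}^i\partial_t^j u$. Let $\tilde f$ be a real- or complex-valued $C^\infty$ function on $I\times I$ with $\tilde f(t,t)$ not identically zero, and let $f(t',t)=\tilde f(t',t)\Theta(t'-t)$. Let $k\ge 0$ and $L=\sum_{j=0}^{k+1}\tilde g_j(t')\delta^{(j)}$, with $\tilde g_j\in C^\infty(I)$ and $\tilde g_{k+1}\not\equiv 0$, be such that $L*\tilde f=0$, i.e. $\sum_{j=0}^{k+1}\tilde g_j(t')\tilde f^{(j,0)}(t',t)=0$. Put $$U=\{\tau\in I^\circ:\ \tilde f(\tau,\tau)\,\tilde g_{k+1}(\tau)\neq 0\}.$$ Then $U$ is open. It is non-empty if $\tilde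 g_{k+1}$ has no zero in $I$, and $U\times U$ has full measure in $I\times I$ if $\tilde f(\tau,\tau)\tilde g_{k+1}(\tau)\ne0$ for almost every $\tau\in I$. The $*$-inverse of $f$ exists on $U$ in the following sense. (a) Let $k>0$. The functions $$\tilde h_m(t)=\sum_{j=m+1}^{k+1}\sum_{\ell=m}^{j-1}\binom{\ell}{m}(-1)^\ell\,\tilde f^{(j-\ell-1,0)}(t,t)\,\tilde g_j^{(\ell-m)}(t)\qquad(0\le m\le k)$$ are smooth on $I^\circ$. There is a smooth $\tilde x$ on $U\times U$ with $$\sum_{m=0}^k\tilde h_m(t)\,\tilde x^{(0,m)}(t',t)=0,\qquad \tilde x^{(0,k-1)}(t',t')=-\frac1{\tilde h_k(t')},\qquad \tilde x^{(0,j)}(t',t')=0\ \ (0\le j\le k-2).$$ Let $\tilde x$ be any function on $U\times U$, smooth in $t$, that satisfies these conditions. Put $x=\tilde x\,\Theta(t'-t)$, $\tilde y_j(t',t)=\tilde x(t',t)\tilde g_j(t)$ and $$\tilde r_{-1}(t',t)=\sum_{j=0}^{k+1}(-1)^j\tilde y_j^{(0,j)}(t',t),\qquad \tilde r_m(t')=\sum_{j=m+1}^{k+1}(-1)^{j-1-m}\,\tilde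 y_j^{(0,j-1-m)}(t',t')\quad(0\le m\le k).$$ Then, on $U\times U$, $$x*L=\tilde r_{-1}(t',t)\Theta+\sum_{m=0}^k\tilde r_m(t')\delta^{(m)},\qquad x*(L*f)=\delta,$$ and $\tilde r_0,\dots,\tilde r_k$ are smooth on $U$. Moreover, for every open interval $J\subseteq U$: $\tilde x$ is on $J\times J$ the only solution of the above problem posed on $J$; $\tilde x$ and $\tilde r_{-1}$ are smooth on $J\times J$; and on $J\times J$ the two-sided $*$-inverse of $f$ is $$f^{*-1}=x*L=\tilde r_{-1}(t',t)\Theta+\sum_{m=0}^k\tilde r_m(t')\delta^{(m)},\qquad\text{i.e. } f^{*-1}*f=f*f^{*-1}=\delta .$$ (b) Let $k=0$, and put $$R=\frac{1}{\tilde g_1(t')\tilde f(t',t')}\,L(t',t).$$ Then $R*f=\delta$ on $U\times U$, and for every open interval $J\subseteq U$, $R$ is the two-sided $*$-inverse of $f$ on $J\times J$. -/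

import Mathlib

open scoped ContDiff

noncomputable section

namespace StarInv

variable {𝕜 : Type*} [RCLike 𝕜]

/-- A generalized function `G(t', t)`, seen as a family, indexed by the left variable `t'`, of
distributions in the right variable `t`: the value `G t' φ` stands for `∫ G(t', t) φ(t) dt`. -/
abbrev GenFun (𝕜 : Type*) := ℝ → (ℝ → 𝕜) → 𝕜

/-- Test functions on `D`: smooth functions with compact support contained in `D`. -/
def IsTest (D : Set ℝ) (φ : ℝ → 𝕜) : Prop :=
  ContDiff ℝ ∞ φ ∧ HasCompactSupport φ ∧ tsupport φ ⊆ D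

/-- Equality of generalized functions on `D × D`: for every `t' ∈ D` the two distributions in `t`
agree on all test functions on `D`. -/
def EqOn (D : Set ℝ) (F G : GenFun 𝕜) : Prop :=
  ∀ t' ∈ D, ∀ φ : ℝ → 𝕜, IsTest D φ → F t' φ = G t' φ

/-- The generalized function `a(t', t) Θ(t' - t)` on `D × D`, with `Θ(0) = 1`. -/
def theta (D : Set ℝ) (a : ℝ → ℝ → 𝕜) : GenFun 𝕜 :=
  fun t' φ => ∫ t in D ∩ Set.Iic t', a t' t * φ t

/-- The generalized function `δ^{(j)}(t' - t)`, the `j`-th derivative of the Dirac distribution at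
`t' - t`; as a distribution in `t` it sends `φ` to `φ^{(j)}(t')`, since
`∫ δ^{(j)}(q) φ(t' - q) dq = φ^{(j)}(t')`. In particular `delta 0` is the unit `δ(t' - t)`. -/
def delta (j : ℕ) : GenFun 𝕜 :=
  fun t' φ => iteratedDeriv j φ t'

/-- Multiplication of a generalized function by an ordinary function of `t'`. -/
def lmul (c : ℝ → 𝕜) (F : GenFun 𝕜) : GenFun 𝕜 :=
  fun t' φ => c t' * F t' φ

/-- The product `(F ∗ G)(t', t) = ∫ F(t', τ) G(τ, t) dτ`: integrated against `φ(t) dt` it is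
`∫ F(t', τ) (∫ G(τ, t) φ(t) dt) dτ`. -/
def star (F G : GenFun 𝕜) : GenFun 𝕜 :=
  fun t' φ => F t' (fun τ => G τ φ)

/-- `R` is a two-sided `∗`-inverse of `F` on `D × D`. -/
def IsStarInverse (D : Set ℝ) (F R : GenFun 𝕜) : Prop :=
  EqOn D (star R F) (delta 0) ∧ EqOn D (star F R) (delta 0)

/-- The differential distribution `L = ∑_{j=0}^{k+1} g_j(t') δ^{(j)}(t' - t)`. -/
def diffDist (k : ℕ) (g : ℕ → ℝ → 𝕜) : GenFun 𝕜 :=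
  ∑ j ∈ Finset.range (k + 2), lmul (g j) (delta j)

/-- The interior points `t` of `I` with `f(t, t) g_{k+1}(t) ≠ 0`. -/
def regularSet (I : Set ℝ) (k : ℕ) (f : ℝ → ℝ → 𝕜) (g : ℕ → ℝ → 𝕜) : Set ℝ :=
  {t | t ∈ interior I ∧ f t t * g (k + 1) t ≠ 0}

/-- The coefficients `h_m(t)` of the differential equation. -/
def hCoeff (k : ℕ) (f : ℝ → ℝ → 𝕜) (g : ℕ → ℝ → 𝕜) (m : ℕ) (t : ℝ) : 𝕜 :=
  ∑ j ∈ Finset.Icc (m + 1) (k + 1), ∑ l ∈ Finset.Icc m (j - 1),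
    (l.choose m : 𝕜) * (-1) ^ l * iteratedDeriv (j - l - 1) (fun s => f s t) t
      * iteratedDeriv (l - m) (g j) t

/-- For every `t' ∈ U` the function `t ↦ x(t', t)` is smooth on `U`, solves
`∑_{m=0}^k h_m(t) x^{(0,m)}(t', t) = 0` there, and satisfies the conditions
`x^{(0,k-1)}(t', t') = -1 / h_k(t')` and `x^{(0,j)}(t', t') = 0` for `0 ≤ j ≤ k - 2`
(meant for `k > 0`). -/
def IsSolution (U : Set ℝ) (k : ℕ) (h : ℕ → ℝ → 𝕜) (x : ℝ → ℝ → 𝕜) : Prop :=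
  ∀ t' ∈ U,
    ContDiffOn ℝ ∞ (x t') U ∧
    (∀ t ∈ U, ∑ m ∈ Finset.range (k + 1), h m t * iteratedDeriv m (x t') t = 0) ∧
    iteratedDeriv (k - 1) (x t') t' = -(h k t')⁻¹ ∧
    ∀ j : ℕ, j + 1 < k → iteratedDeriv j (x t') t' = 0

/-- `r_{-1}(t', t) = ∑_{j=0}^{k+1} (-1)^j y_j^{(0,j)}(t', t)` with
`y_j(t', t) = x(t', t) g_j(t)`. -/
def rReg (k : ℕ) (g : ℕ → ℝ → 𝕜) (x : ℝ → ℝ → 𝕜) (t' t : ℝ) : 𝕜 :=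
  ∑ j ∈ Finset.range (k + 2), (-1) ^ j * iteratedDeriv j (fun s => x t' s * g j s) t

/-- `r_m(t') = ∑_{j=m+1}^{k+1} (-1)^{j-1-m} y_j^{(0,j-1-m)}(t', t')` with
`y_j(t', t) = x(t', t) g_j(t)`. -/
def rSing (k : ℕ) (g : ℕ → ℝ → 𝕜) (x : ℝ → ℝ → 𝕜) (m : ℕ) (t' : ℝ) : 𝕜 :=
  ∑ j ∈ Finset.Icc (m + 1) (k + 1),
    (-1) ^ (j - 1 - m) * iteratedDeriv (j - 1 - m) (fun s => x t' s * g j s) t'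

/-- The generalized function `r_{-1}(t', t) Θ(t' - t) + ∑_{m=0}^k r_m(t') δ^{(m)}(t' - t)` on
`D × D`. -/
def invDist (D : Set ℝ) (k : ℕ) (g : ℕ → ℝ → 𝕜) (x : ℝ → ℝ → 𝕜) : GenFun 𝕜 :=
  theta D (rReg k g x) + ∑ m ∈ Finset.range (k + 1), lmul (rSing k g x m) (delta m)

end StarInv

end

/-! Differentiate `f ∗ ψ = ∫_{t ≤ t'} f(t', t) ψ(t) dt` repeatedly in `t'`: each derivative splits
into boundary terms on the diagonal and an integral against `f^{(j,0)}`. Weighted by the `g_j` and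
summed, the integrals cancel because `L` annihilates `f`. Hence `L ∗ f` is a differential operator
`P` of order `k` (`diffDist_theta`, `starOp_eq_sum`), with leading coefficient `g_{k+1}(t) f(t, t)`,
which has no zero on `U`. If `k = 0`, then `P` is multiplication by a function and division inverts
it.

If `k > 0`, the `h_m` are the coefficients of the formal adjoint of `P` (`sum_adjoint_eq`), and `x
Θ` is the causal Green function of `P`. Integration by parts in `∫ x Pψ` moves `P` onto `x`, where
it gives zero, and the prescribed jet of `x` on the diagonal leaves a single boundary term, equal to
`ψ(t')` (`integral_mul_starOp`). So `x ∗ (L ∗ f) = δ`. Integration by parts against `L` alone puts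
`x ∗ L` in normal form (`theta_diffDist`).

A left inverse `R` is also a right inverse on an interval `J` because `f ∗ ·` is onto the smooth
functions on `J` that vanish left of some point of `J` (`exists_theta_eq`). Given such a `φ`, solve
`Pψ = Lφ` with `ψ` vanishing on the same side; then `L(f ∗ ψ - φ) = 0`, and uniqueness for `L` gives
`f ∗ ψ = φ`. Therefore `R φ = R(f ∗ ψ) = ψ` and `f ∗ (R φ) = φ` (`isStarInverse_of_left_inverse`).

Global existence and uniqueness for linear equations enter throughout. Both are intrinsically
statements about intervals, which is why the two-sided inverse and the uniqueness of `x` are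
asserted on `J` and not on `U`. -/

namespace StarInv

open Set Filter Topology MeasureTheory

/-! ### Linear first order systems on an open interval -/

section LinearSystems

variable {E : Type*} [NormedAddCommGroup E] [NormedSpace ℝ E] {J : Set ℝ} {t₀ : ℝ}

theorem hasDerivAt_integral_of_continuousOn [CompleteSpace E] (hJ : IsOpen J)
    (hJc : J.OrdConnected) (ht₀ : t₀ ∈ J) {φ : ℝ → E} (hφ : ContinuousOn φ J) {t : ℝ}
    (ht : t ∈ J) : HasDerivAt (fun t => ∫ s in t₀..t, φ s) (φ t) t :=
  intervalIntegral.integral_hasDerivAt_right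
    ((hφ.mono (hJc.uIcc_subset ht₀ ht)).intervalIntegrable)
    (hφ.stronglyMeasurableAtFilter hJ t ht) (hφ.continuousAt (hJ.mem_nhds ht))

/-- Coefficients may be unbounded on `J`; on the compact interval found here they are bounded. With
`s = t` it also supplies a point of `J` strictly to the left of a given one. -/
theorem exists_Ioo_of_mem (hJ : IsOpen J) (hJc : J.OrdConnected) {s t : ℝ} (hs : s ∈ J)
    (ht : t ∈ J) : ∃ a b, s ∈ Ioo a b ∧ t ∈ Ioo a b ∧ Icc a b ⊆ J := by
  have key : ∀ r ∈ J, ∃ a ∈ J, ∃ b ∈ J, a < r ∧ r < b := by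
    intro r hr
    obtain ⟨ε, hε, h⟩ := Metric.isOpen_iff.1 hJ r hr
    refine ⟨r - ε / 2, h ?_, r + ε / 2, h ?_, by linarith, by linarith⟩ <;>
    · simp [abs_of_pos hε]
      linarith
  obtain ⟨a, ha, b, hb, h1, h2⟩ := key s hs
  obtain ⟨a', ha', b', hb', h1', h2'⟩ := key t ht
  refine ⟨min a a', max b b', ⟨by simp [h1], by simp [h2]⟩, ⟨by simp [h1'], by simp [h2']⟩,
    hJc.out ?_ ?_⟩
  · rcases min_choice a a' with h | h <;> rwa [h]
  · rcases max_choice b b' with h | h <;> rwa [h]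

/-- The terms of the Picard series of the linear equation `u' = A u + b`, `u t₀ = c`. -/
noncomputable def picardTerm (A : ℝ → E →L[ℝ] E) (b : ℝ → E) (t₀ : ℝ) (c : E) : ℕ → ℝ → E
  | 0 => fun t => c + ∫ s in t₀..t, b s
  | n + 1 => fun t => ∫ s in t₀..t, A s (picardTerm A b t₀ c n s)

variable {A : ℝ → E →L[ℝ] E} {b : ℝ → E} {c : E}

theorem continuousOn_picardTerm [CompleteSpace E] (hJ : IsOpen J) (hJc : J.OrdConnected)
    (ht₀ : t₀ ∈ J) (hA : ContinuousOn A J) (hb : ContinuousOn b J) (n : ℕ) :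
    ContinuousOn (picardTerm A b t₀ c n) J := by
  induction n with
  | zero =>
    exact continuousOn_const.add fun t ht =>
      (hasDerivAt_integral_of_continuousOn hJ hJc ht₀ hb ht).continuousAt.continuousWithinAt
  | succ n ih =>
    exact fun t ht => (hasDerivAt_integral_of_continuousOn hJ hJc ht₀ (hA.clm_apply ih)
      ht).continuousAt.continuousWithinAt

/-- The factorial comes from iterating the integral of `|s - t₀| ^ n`. It beats any power of `M`, so
the Picard series converges on all of `J` and not just for short times. -/
theorem norm_picardTerm_le {α β M C : ℝ} (ht₀ : t₀ ∈ Icc α β)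
    (hAM : ∀ t ∈ Icc α β, ‖A t‖ ≤ M) (hC : ∀ t ∈ Icc α β, ‖picardTerm A b t₀ c 0 t‖ ≤ C) (n : ℕ)
    {t : ℝ} (ht : t ∈ Icc α β) :
    ‖picardTerm A b t₀ c n t‖ ≤ C * (M ^ n * |t - t₀| ^ n / n.factorial) := by
  induction n generalizing t with
  | zero => simpa using hC t ht
  | succ n ih =>
    have hC0 : 0 ≤ C := (norm_nonneg _).trans (hC t ht)
    calc ‖∫ s in t₀..t, A s (picardTerm A b t₀ c n s)‖
        ≤ ∫ s in uIoc t₀ t, C * (M ^ (n + 1) / n.factorial) * |s - t₀| ^ n := by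
          rw [intervalIntegral.norm_intervalIntegral_eq]
          apply norm_integral_le_of_norm_le (Continuous.integrableOn_uIoc (by fun_prop))
          refine (ae_restrict_mem measurableSet_Ioc).mono fun s hs => ?_
          have hs' : s ∈ Icc α β := uIcc_subset_Icc ht₀ ht (uIoc_subset_uIcc hs)
          calc ‖A s (picardTerm A b t₀ c n s)‖
              ≤ M * (C * (M ^ n * |s - t₀| ^ n / n.factorial)) :=
                (A s).le_of_opNorm_le_of_le (hAM s hs') (ih hs')
            _ = _ := by ring
      _ = C * (M ^ (n + 1) * |t - t₀| ^ (n + 1) / (n + 1).factorial) := by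
          rw [integral_const_mul, integral_pow_abs_sub_uIoc, Nat.factorial_succ]
          push_cast
          field_simp

/-- Global existence for inhomogeneous linear systems on an open interval. -/
theorem exists_hasDerivAt_linear [CompleteSpace E] (hJ : IsOpen J) (hJc : J.OrdConnected)
    (ht₀ : t₀ ∈ J) (hA : ContinuousOn A J) (hb : ContinuousOn b J) (c : E) :
    ∃ u : ℝ → E, u t₀ = c ∧ ∀ t ∈ J, HasDerivAt u (A t (u t) + b t) t := by
  set w := picardTerm A b t₀ c with hw
  have hwc := continuousOn_picardTerm (c := c) hJ hJc ht₀ hA hb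
  -- One series defines the solution on all of `J`; compact subintervals serve only to differentiate
  -- it term by term.
  refine ⟨fun t => ∑' n, w n t, ?_, fun t ht => ?_⟩
  · show ∑' n, w n t₀ = c
    rw [tsum_eq_single 0]
    · simp [hw, picardTerm]
    · rintro (_ | n) hn
      · simp at hn
      · simp [hw, picardTerm]
  obtain ⟨α, β, h0, h1, hαβ⟩ := exists_Ioo_of_mem hJ hJc ht₀ ht
  obtain ⟨M, hM⟩ := isCompact_Icc.exists_bound_of_continuousOn (hA.mono hαβ)
  obtain ⟨C, hC⟩ := isCompact_Icc.exists_bound_of_continuousOn ((hwc 0).mono hαβ)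
  obtain ⟨B, hB⟩ := isCompact_Icc.exists_bound_of_continuousOn (hb.mono hαβ)
  have hM0 : 0 ≤ M := (norm_nonneg _).trans (hM t₀ (Ioo_subset_Icc_self h0))
  have hC0 : 0 ≤ C := (norm_nonneg _).trans (hC t₀ (Ioo_subset_Icc_self h0))
  have hbd : ∀ n, ∀ s ∈ Ioo α β, ‖w n s‖ ≤ C * ((M * (β - α)) ^ n / n.factorial) := by
    intro n s hs
    refine (norm_picardTerm_le (Ioo_subset_Icc_self h0) hM hC n
      (Ioo_subset_Icc_self hs)).trans ?_
    rw [mul_pow]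
    have : |s - t₀| ≤ β - α := abs_le.2 ⟨by linarith [hs.1, h0.2], by linarith [hs.2, h0.1]⟩
    gcongr
  have hsum : Summable fun n : ℕ => C * ((M * (β - α)) ^ n / n.factorial) :=
    (Real.summable_pow_div_factorial _).mul_left _
  have hws : Summable fun n => w n t := .of_norm_bounded hsum fun n => hbd n t h1
  -- The derivatives of the terms are `b`, `A w₀`, `A w₁`, …, with sum `b + A ∑ w n`.
  let w' : ℕ → ℝ → E := fun n s => n.casesOn (b s) fun n => A s (w n s)
  let bd : ℕ → ℝ := fun n => n.casesOn B fun n => M * (C * ((M * (β - α)) ^ n / n.factorial))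
  have hd := hasDerivAt_tsum_of_isPreconnected (g := w) (g' := w') (u := bd) (t := Ioo α β)
    (y₀ := t) (y := t) ((summable_nat_add_iff 1).1 (hsum.mul_left M)) isOpen_Ioo isPreconnected_Ioo
    (fun n s hs => by
      have hsJ := hαβ (Ioo_subset_Icc_self hs)
      cases n with
      | zero => exact (hasDerivAt_integral_of_continuousOn hJ hJc ht₀ hb hsJ).const_add c
      | succ n =>
        exact hasDerivAt_integral_of_continuousOn hJ hJc ht₀ (hA.clm_apply (hwc n)) hsJ)
    (fun n s hs => by
      cases n with
      | zero => exact hB s (Ioo_subset_Icc_self hs)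
      | succ n => exact (A s).le_of_opNorm_le_of_le (hM s (Ioo_subset_Icc_self hs)) (hbd n s hs))
    h1 hws h1
  convert hd using 1
  have hs' : Summable fun n => w' n t :=
    (summable_nat_add_iff 1).1 ((A t).summable hws)
  rw [hs'.tsum_eq_zero_add, (A t).map_tsum hws, add_comm]
  rfl

/-- Uniqueness for linear systems on an open interval. -/
theorem eqOn_of_hasDerivAt_linear (hJ : IsOpen J) (hJc : J.OrdConnected) (ht₀ : t₀ ∈ J)
    (hA : ContinuousOn A J) {u v : ℝ → E} (hu : ∀ t ∈ J, HasDerivAt u (A t (u t) + b t) t)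
    (hv : ∀ t ∈ J, HasDerivAt v (A t (v t) + b t) t) (h : u t₀ = v t₀) : Set.EqOn u v J := by
  intro t ht
  obtain ⟨α, β, h0, h1, hαβ⟩ := exists_Ioo_of_mem hJ hJc ht₀ ht
  obtain ⟨M, hM⟩ := isCompact_Icc.exists_bound_of_continuousOn (hA.mono hαβ)
  have hs : ∀ s ∈ Ioo α β, s ∈ J := fun s hs => hαβ (Ioo_subset_Icc_self hs)
  refine ODE_solution_unique_of_mem_Ioo (K := M.toNNReal) (v := fun t y => A t y + b t)
    (s := fun _ => univ) (fun s hs => ?_) h0 (fun s h => ⟨hu s (hs s h), trivial⟩)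
    (fun s h => ⟨hv s (hs s h), trivial⟩) h h1
  refine (LipschitzWith.of_dist_le_mul fun x y => ?_).lipschitzOnWith
  rw [dist_add_right, dist_eq_norm, dist_eq_norm, ← map_sub]
  exact (A s).le_of_opNorm_le ((hM s (Ioo_subset_Icc_self hs)).trans (Real.le_coe_toNNReal M)) _

/-- Bootstrap: if `u` is `C^n`, then so is `u' = A u + b`, hence `u` is `C^(n+1)`. -/
theorem contDiffOn_of_hasDerivAt_linear (hJ : IsOpen J) (hA : ContDiffOn ℝ ∞ A J)
    (hb : ContDiffOn ℝ ∞ b J) {u : ℝ → E} (hu : ∀ t ∈ J, HasDerivAt u (A t (u t) + b t) t) :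
    ContDiffOn ℝ ∞ u J := by
  refine contDiffOn_infty.2 fun n => ?_
  induction n with
  | zero =>
    exact contDiffOn_zero.2 fun t ht => (hu t ht).continuousAt.continuousWithinAt
  | succ n ih =>
    push_cast
    refine (contDiffOn_succ_iff_deriv_of_isOpen hJ).2
      ⟨fun t ht => (hu t ht).differentiableAt.differentiableWithinAt, by simp, ?_⟩
    exact (((hA.of_le (by exact_mod_cast le_top)).clm_apply ih).add
      (hb.of_le (by exact_mod_cast le_top))).congr fun t ht => (hu t ht).deriv

end LinearSystems

/-! ### Iterated derivatives of smooth functions on open sets -/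

section IteratedDerivatives

variable {F : Type*} [NormedAddCommGroup F] [NormedSpace ℝ F] {U : Set ℝ} {u : ℝ → F}

theorem contDiffOn_iteratedDeriv (hU : IsOpen U) (hu : ContDiffOn ℝ ∞ u U) (n : ℕ) :
    ContDiffOn ℝ ∞ (iteratedDeriv n u) U := by
  induction n with
  | zero => simpa using hu
  | succ n ih =>
    rw [iteratedDeriv_succ]
    exact ih.deriv_of_isOpen hU (by simp)

theorem contDiffAt_of_mem (hU : IsOpen U) (hu : ContDiffOn ℝ ∞ u U) {t : ℝ} (ht : t ∈ U)
    (n : ℕ) : ContDiffAt ℝ n u t :=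
  (hu.contDiffAt (hU.mem_nhds ht)).of_le (by exact_mod_cast le_top)

theorem hasDerivAt_of_contDiffOn (hU : IsOpen U) (hu : ContDiffOn ℝ ∞ u U) {t : ℝ} (ht : t ∈ U) :
    HasDerivAt u (deriv u t) t :=
  ((hu.contDiffAt (hU.mem_nhds ht)).differentiableAt (by simp)).hasDerivAt

theorem hasDerivAt_iteratedDeriv (hU : IsOpen U) (hu : ContDiffOn ℝ ∞ u U) (n : ℕ) {t : ℝ}
    (ht : t ∈ U) : HasDerivAt (iteratedDeriv n u) (iteratedDeriv (n + 1) u t) t := by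
  rw [iteratedDeriv_succ]
  exact hasDerivAt_of_contDiffOn hU (contDiffOn_iteratedDeriv hU hu n) ht

end IteratedDerivatives

/-! ### Scalar linear equations of higher order -/

section ScalarEquations

variable {𝕜 : Type*} [RCLike 𝕜] {J : Set ℝ} {t₀ : ℝ} {n : ℕ} {p : ℕ → ℝ → 𝕜} {χ : ℝ → 𝕜}

theorem contDiffOn_div {X : Type*} [NormedAddCommGroup X] [NormedSpace ℝ X] {s : Set X}
    {a b : X → 𝕜} (ha : ContDiffOn ℝ ∞ a s) (hb : ContDiffOn ℝ ∞ b s) (h : ∀ x ∈ s, b x ≠ 0) :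
    ContDiffOn ℝ ∞ (fun x => a x / b x) s := by
  simp only [div_eq_mul_inv]
  exact ha.mul (hb.inv h)

/-- The companion matrix of the equation `u^(n+1) = ∑_{m ≤ n} q_m u^(m)`. -/
noncomputable def companion (n : ℕ) (q : ℕ → 𝕜) : (Fin (n + 1) → 𝕜) →L[ℝ] (Fin (n + 1) → 𝕜) :=
  ContinuousLinearMap.pi fun i =>
    Fin.lastCases (motive := fun _ => (Fin (n + 1) → 𝕜) →L[ℝ] 𝕜)
      (∑ m : Fin (n + 1), q m • ContinuousLinearMap.proj m)
      (fun j => ContinuousLinearMap.proj j.succ) i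

@[simp]
theorem companion_apply_last (q : ℕ → 𝕜) (v : Fin (n + 1) → 𝕜) :
    companion n q v (Fin.last n) = ∑ m : Fin (n + 1), q m * v m := by
  simp [companion]

@[simp]
theorem companion_apply_castSucc (q : ℕ → 𝕜) (v : Fin (n + 1) → 𝕜) (i : Fin n) :
    companion n q v i.castSucc = v i.succ := by
  simp [companion]

theorem contDiffOn_companion {q : ℕ → ℝ → 𝕜} (hq : ∀ m ≤ n, ContDiffOn ℝ ∞ (q m) J) :
    ContDiffOn ℝ ∞ (fun t => companion n fun m => q m t) J := by
  refine contDiffOn_clm_apply.2 fun v => contDiffOn_pi.2 fun i => ?_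
  induction i using Fin.lastCases with
  | last =>
    simp only [companion_apply_last]
    exact ContDiffOn.sum fun m _ => (hq m (by omega)).mul contDiffOn_const
  | cast i =>
    simp only [companion_apply_castSucc]
    exact contDiffOn_const

/-- The first order system for the jet of a solution of a scalar linear equation. -/
theorem hasDerivAt_jet (hJ : IsOpen J) (hp0 : ∀ t ∈ J, p (n + 1) t ≠ 0) {u : ℝ → 𝕜}
    (hu : ContDiffOn ℝ ∞ u J)
    (h : ∀ t ∈ J, ∑ m ∈ Finset.range (n + 2), p m t * iteratedDeriv m u t = χ t) {t : ℝ}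
    (ht : t ∈ J) :
    HasDerivAt (fun t (i : Fin (n + 1)) => iteratedDeriv i u t)
      (companion n (fun m => -(p m t / p (n + 1) t)) (fun i => iteratedDeriv i u t) +
        Pi.single (Fin.last n) (χ t / p (n + 1) t)) t := by
  refine hasDerivAt_pi.2 fun i => ?_
  induction i using Fin.lastCases with
  | last =>
    have h1 := h t ht
    rw [Finset.sum_range_succ] at h1
    have h2 : (∑ m : Fin (n + 1), -(p m t / p (n + 1) t) * iteratedDeriv m u t) +
        χ t / p (n + 1) t = iteratedDeriv (n + 1) u t := by
      rw [Fin.sum_univ_eq_sum_range (fun m => -(p m t / p (n + 1) t) * iteratedDeriv m u t),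
        ← h1, add_div, mul_div_cancel_left₀ _ (hp0 t ht), Finset.sum_div, ← add_assoc,
        ← Finset.sum_add_distrib, Finset.sum_eq_zero, zero_add]
      intros
      ring
    simp only [Pi.add_apply, companion_apply_last, Pi.single_eq_same, h2]
    exact hasDerivAt_iteratedDeriv hJ hu n ht
  | cast i =>
    simpa using hasDerivAt_iteratedDeriv hJ hu i ht

theorem contDiffOn_companion_quotient (hp : ∀ m ≤ n + 1, ContDiffOn ℝ ∞ (p m) J)
    (hp0 : ∀ t ∈ J, p (n + 1) t ≠ 0) :
    ContDiffOn ℝ ∞ (fun t => companion n fun m => -(p m t / p (n + 1) t)) J :=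
  contDiffOn_companion (q := fun m t => -(p m t / p (n + 1) t)) fun m hm =>
    (contDiffOn_div (hp m (by omega)) (hp _ le_rfl) hp0).neg

/-- Uniqueness for scalar linear equations of order `n + 1` on an open interval. -/
theorem eqOn_of_linear_equation (hJ : IsOpen J) (hJc : J.OrdConnected) (ht₀ : t₀ ∈ J)
    (hp : ∀ m ≤ n + 1, ContDiffOn ℝ ∞ (p m) J) (hp0 : ∀ t ∈ J, p (n + 1) t ≠ 0) {u v : ℝ → 𝕜}
    (hu : ContDiffOn ℝ ∞ u J)
    (hu' : ∀ t ∈ J, ∑ m ∈ Finset.range (n + 2), p m t * iteratedDeriv m u t = χ t)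
    (hv : ContDiffOn ℝ ∞ v J)
    (hv' : ∀ t ∈ J, ∑ m ∈ Finset.range (n + 2), p m t * iteratedDeriv m v t = χ t)
    (h : ∀ i ≤ n, iteratedDeriv i u t₀ = iteratedDeriv i v t₀) : Set.EqOn u v J := by
  intro t ht
  have := eqOn_of_hasDerivAt_linear hJ hJc ht₀ (contDiffOn_companion_quotient hp hp0).continuousOn
    (fun t ht => hasDerivAt_jet hJ hp0 hu hu' ht) (fun t ht => hasDerivAt_jet hJ hp0 hv hv' ht)
    (funext fun i => h i (by omega)) ht
  simpa using congrFun this 0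

/-- Existence for scalar linear equations of order `n + 1` on an open interval. -/
theorem exists_solution_linear_equation (hJ : IsOpen J) (hJc : J.OrdConnected) (ht₀ : t₀ ∈ J)
    (hp : ∀ m ≤ n + 1, ContDiffOn ℝ ∞ (p m) J) (hp0 : ∀ t ∈ J, p (n + 1) t ≠ 0)
    (hχ : ContDiffOn ℝ ∞ χ J) (c : Fin (n + 1) → 𝕜) :
    ∃ u : ℝ → 𝕜, ContDiffOn ℝ ∞ u J ∧
      (∀ t ∈ J, ∑ m ∈ Finset.range (n + 2), p m t * iteratedDeriv m u t = χ t) ∧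
      ∀ i : Fin (n + 1), iteratedDeriv i u t₀ = c i := by
  have hA := contDiffOn_companion_quotient hp hp0
  have hb : ContDiffOn ℝ ∞
      (fun t => (Pi.single (Fin.last n) (χ t / p (n + 1) t) : Fin (n + 1) → 𝕜)) J := by
    refine contDiffOn_pi.2 fun i => ?_
    by_cases hi : i = Fin.last n
    · subst hi
      simpa using contDiffOn_div hχ (hp _ le_rfl) hp0
    · simpa [hi] using contDiffOn_const
  obtain ⟨v, hv0, hv⟩ := exists_hasDerivAt_linear hJ hJc ht₀ hA.continuousOn hb.continuousOn c
  have hvs := contDiffOn_of_hasDerivAt_linear hJ hA hb hv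
  -- The upper rows of the companion system force each component to be the derivative of the
  -- preceding one.
  have hcomp : ∀ i : Fin (n + 1), ∀ t ∈ J, iteratedDeriv i (fun t => v t 0) t = v t i := by
    intro i
    induction i using Fin.induction with
    | zero => simp
    | succ i ih =>
      intro t ht
      have h1 := hasDerivAt_pi.1 (hv t ht) i.castSucc
      simp only [Pi.add_apply, companion_apply_castSucc,
        Pi.single_eq_of_ne (Fin.castSucc_lt_last i).ne, add_zero] at h1
      rw [Fin.val_succ, iteratedDeriv_succ, ← h1.deriv]
      exact EventuallyEq.deriv_eq (eventually_of_mem (hJ.mem_nhds ht) ih)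
  refine ⟨fun t => v t 0, contDiffOn_pi.1 hvs 0, fun t ht => ?_, fun i => ?_⟩
  · have h1 := hasDerivAt_pi.1 (hv t ht) (Fin.last n)
    simp only [Pi.add_apply, companion_apply_last, Pi.single_eq_same] at h1
    have h2 : iteratedDeriv (n + 1) (fun t => v t 0) t =
        ∑ m : Fin (n + 1), -(p m t / p (n + 1) t) * v t m + χ t / p (n + 1) t := by
      rw [iteratedDeriv_succ, ← h1.deriv]
      exact EventuallyEq.deriv_eq (eventually_of_mem (hJ.mem_nhds ht) (hcomp (Fin.last n)))
    rw [Finset.sum_range_succ, h2, mul_add, mul_div_cancel₀ _ (hp0 t ht), ← add_assoc,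
      ← Fin.sum_univ_eq_sum_range (fun m => p m t * iteratedDeriv m (fun t => v t 0) t),
      Finset.mul_sum, ← Finset.sum_add_distrib, Finset.sum_eq_zero, zero_add]
    intro m _
    rw [hcomp m t ht]
    field_simp [hp0 t ht]
    ring
  · rw [hcomp i t₀ ht₀, hv0]

end ScalarEquations

/-! ### Partial derivatives of smooth functions of two variables -/

section PartialDerivatives

variable {F : Type*} [NormedAddCommGroup F] [NormedSpace ℝ F] {S T : Set ℝ} {f : ℝ → ℝ → F}

theorem hasDerivAt_left (hS : IsOpen S) (hT : IsOpen T)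
    (hf : ContDiffOn ℝ ∞ (fun p : ℝ × ℝ => f p.1 p.2) (S ×ˢ T)) {s t : ℝ} (hs : s ∈ S)
    (ht : t ∈ T) : HasDerivAt (fun s => f s t)
      (fderiv ℝ (fun p : ℝ × ℝ => f p.1 p.2) (s, t) (1, 0)) s := by
  have h : HasFDerivAt (fun p : ℝ × ℝ => f p.1 p.2) _ (s, t) :=
    ((hf.contDiffAt ((hS.prod hT).mem_nhds ⟨hs, ht⟩)).differentiableAt (by simp)).hasFDerivAt
  exact h.comp_hasDerivAt s ((hasDerivAt_id s).prodMk (hasDerivAt_const s t))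

theorem contDiffOn_deriv_left (hS : IsOpen S) (hT : IsOpen T)
    (hf : ContDiffOn ℝ ∞ (fun p : ℝ × ℝ => f p.1 p.2) (S ×ˢ T)) :
    ContDiffOn ℝ ∞ (fun p : ℝ × ℝ => deriv (fun s => f s p.2) p.1) (S ×ˢ T) :=
  ((hf.fderiv_of_isOpen (hS.prod hT) (m := ∞) (by simp)).clm_apply contDiffOn_const).congr
    fun p hp => (hasDerivAt_left hS hT hf hp.1 hp.2).deriv

theorem contDiffOn_iteratedDeriv_left (hS : IsOpen S) (hT : IsOpen T)
    (hf : ContDiffOn ℝ ∞ (fun p : ℝ × ℝ => f p.1 p.2) (S ×ˢ T)) (n : ℕ) :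
    ContDiffOn ℝ ∞ (fun p : ℝ × ℝ => iteratedDeriv n (fun s => f s p.2) p.1) (S ×ˢ T) := by
  induction n with
  | zero => simpa using hf
  | succ n ih =>
    simp only [iteratedDeriv_succ]
    exact contDiffOn_deriv_left (f := fun s t => iteratedDeriv n (fun s => f s t) s) hS hT ih

theorem contDiffOn_swap (hf : ContDiffOn ℝ ∞ (fun p : ℝ × ℝ => f p.1 p.2) (S ×ˢ T)) :
    ContDiffOn ℝ ∞ (fun p : ℝ × ℝ => f p.2 p.1) (T ×ˢ S) :=
  hf.comp (contDiff_snd.prodMk contDiff_fst).contDiffOn fun _ hp => ⟨hp.2, hp.1⟩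

theorem contDiffOn_iteratedDeriv_right (hS : IsOpen S) (hT : IsOpen T)
    (hf : ContDiffOn ℝ ∞ (fun p : ℝ × ℝ => f p.1 p.2) (S ×ˢ T)) (n : ℕ) :
    ContDiffOn ℝ ∞ (fun p : ℝ × ℝ => iteratedDeriv n (f p.1) p.2) (S ×ˢ T) :=
  contDiffOn_swap (f := fun t s => iteratedDeriv n (f s) t)
    (contDiffOn_iteratedDeriv_left (f := fun t s => f s t) hT hS (contDiffOn_swap hf) n)

theorem contDiffOn_slice (hf : ContDiffOn ℝ ∞ (fun p : ℝ × ℝ => f p.1 p.2) (S ×ˢ T)) {s : ℝ}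
    (hs : s ∈ S) : ContDiffOn ℝ ∞ (f s) T :=
  hf.comp (g := fun p : ℝ × ℝ => f p.1 p.2) (f := fun t => (s, t))
    (contDiff_const.prodMk contDiff_id).contDiffOn fun _ ht => ⟨hs, ht⟩

theorem contDiffOn_diag (hf : ContDiffOn ℝ ∞ (fun p : ℝ × ℝ => f p.1 p.2) (S ×ˢ S)) :
    ContDiffOn ℝ ∞ (fun t => f t t) S :=
  hf.comp (g := fun p : ℝ × ℝ => f p.1 p.2) (f := fun t => (t, t))
    (contDiff_id.prodMk contDiff_id).contDiffOn fun _ ht => ⟨ht, ht⟩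

end PartialDerivatives

/-! ### Integration by parts on an open set, left of a point -/

section IntegrationByParts

variable {𝕜 : Type*} [RCLike 𝕜] {U : Set ℝ} {t' : ℝ} {ψ u w : ℝ → 𝕜}

/-- Left of `t'`, the function `ψ` on `U` is supported in a compact subset of `U`. -/
def LeftCompact (U : Set ℝ) (t' : ℝ) (ψ : ℝ → 𝕜) : Prop :=
  ∃ K, IsCompact K ∧ K ⊆ U ∧ ∀ t ∈ U, t < t' → t ∉ K → ψ t = 0

theorem LeftCompact.mono {s : ℝ} (h : LeftCompact U t' ψ) (hs : s ≤ t') : LeftCompact U s ψ := by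
  obtain ⟨K, hK, hKU, hψ⟩ := h
  exact ⟨K, hK, hKU, fun t ht hts => hψ t ht (hts.trans_le hs)⟩

theorem LeftCompact.mul_left (h : LeftCompact U t' ψ) (a : ℝ → 𝕜) :
    LeftCompact U t' fun t => a t * ψ t := by
  obtain ⟨K, hK, hKU, hψ⟩ := h
  exact ⟨K, hK, hKU, fun t ht hts htK => by simp [hψ t ht hts htK]⟩

/-- The conditions `t ∈ U`, `t < t'`, `t ∉ K` are all open, so the function vanishes near such `t`.
This is why the inequality in `LeftCompact` is strict. -/
theorem LeftCompact.iterate_deriv (hU : IsOpen U) (h : LeftCompact U t' ψ) (n : ℕ) :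
    LeftCompact U t' (iteratedDeriv n ψ) := by
  obtain ⟨K, hK, hKU, hψ⟩ := h
  refine ⟨K, hK, hKU, fun t ht hts htK => ?_⟩
  have : ψ =ᶠ[𝓝 t] fun _ => 0 := by
    filter_upwards [hU.mem_nhds ht, Iio_mem_nhds hts, hK.isClosed.isOpen_compl.mem_nhds htK]
      with s h1 h2 h3 using hψ s h1 h2 h3
  rw [this.iteratedDeriv_eq]
  simp

theorem LeftCompact.integrableOn (hU : IsOpen U) (h : LeftCompact U t' w)
    (hw : ContinuousOn w U) : IntegrableOn w (U ∩ Iic t') := by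
  obtain ⟨K, hK, hKU, hψ⟩ := h
  refine IntegrableOn.of_ae_sdiff_eq_zero ((hw.mono hKU).integrableOn_compact hK)
    (hU.measurableSet.inter measurableSet_Iic).nullMeasurableSet ?_
  filter_upwards [Measure.ae_ne volume t'] with t ht h
  exact hψ t h.1.1 (lt_of_le_of_ne h.1.2 ht) h.2

/-- `U` need not be an interval, so `w` is extended by zero outside `U`. Left of `t'` the extension
is differentiable everywhere, since `w` vanishes off a compact `K ⊆ U`, and the fundamental theorem
applies on the whole half-line. -/
theorem LeftCompact.integral_deriv (hU : IsOpen U) (ht' : t' ∈ U) (h : LeftCompact U t' w)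
    (hw : ContDiffOn ℝ ∞ w U) : ∫ t in U ∩ Iic t', deriv w t = w t' := by
  have hint : IntegrableOn (deriv w) (U ∩ Iic t') := by
    have h1 := (h.iterate_deriv hU 1).integrableOn hU
      (contDiffOn_iteratedDeriv hU hw 1).continuousOn
    rwa [iteratedDeriv_one] at h1
  obtain ⟨K, hK, hKU, hψ⟩ := h
  rw [inter_comm, ← setIntegral_indicator hU.measurableSet]
  have heq : w t' = U.indicator w t' - 0 := by simp [ht']
  have hnear : ∀ t ∈ U, U.indicator w =ᶠ[𝓝 t] w := fun t ht => by
    filter_upwards [hU.mem_nhds ht] with s hs using indicator_of_mem hs w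
  rw [heq]
  refine integral_Iic_of_hasDerivAt_of_tendsto ?_ (fun t ht => ?_) ?_ ?_
  · exact ((hasDerivAt_of_contDiffOn hU hw ht').congr_of_eventuallyEq
      (hnear t' ht')).continuousAt.continuousWithinAt
  · by_cases htU : t ∈ U
    · rw [indicator_of_mem htU]
      exact (hasDerivAt_of_contDiffOn hU hw htU).congr_of_eventuallyEq (hnear t htU)
    · rw [indicator_of_notMem htU]
      refine (hasDerivAt_const t (0 : 𝕜)).congr_of_eventuallyEq ?_
      filter_upwards [Iio_mem_nhds ht, hK.isClosed.isOpen_compl.mem_nhds fun h => htU (hKU h)]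
        with s h1 h2
      by_cases hs : s ∈ U
      · rw [indicator_of_mem hs, hψ s hs h1 h2]
      · exact indicator_of_notMem hs w
  · rw [integrableOn_indicator_iff hU.measurableSet]
    exact hint
  · obtain ⟨m, hm⟩ := hK.bddBelow
    refine tendsto_const_nhds.congr' ?_
    filter_upwards [Iio_mem_atBot m, Iio_mem_atBot t'] with s h1 h2
    by_cases hs : s ∈ U
    · rw [indicator_of_mem hs, hψ s hs h2 fun h => (hm h).not_gt h1]
    · exact (indicator_of_notMem hs w).symm

/-- Repeated integration by parts against a function with left-compact support. -/
theorem LeftCompact.integral_mul_iteratedDeriv (hU : IsOpen U) (ht' : t' ∈ U)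
    (hψc : LeftCompact U t' ψ) (hψ : ContDiffOn ℝ ∞ ψ U) (hu : ContDiffOn ℝ ∞ u U) (j : ℕ) :
    ∫ t in U ∩ Iic t', u t * iteratedDeriv j ψ t =
      ∑ s ∈ Finset.range j, (-1) ^ s * iteratedDeriv s u t' * iteratedDeriv (j - 1 - s) ψ t' +
        ∫ t in U ∩ Iic t', (-1) ^ j * iteratedDeriv j u t * ψ t := by
  induction j generalizing u with
  | zero => simp
  | succ j ih =>
    have hψj := contDiffOn_iteratedDeriv hU hψ j
    have hψjc := hψc.iterate_deriv hU j
    have hu1 : ContDiffOn ℝ ∞ (deriv u) U := hu.deriv_of_isOpen hU (by simp)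
    have hI1 := (hψjc.mul_left (deriv u)).integrableOn hU (hu1.mul hψj).continuousOn
    have hI2 := ((hψc.iterate_deriv hU (j + 1)).mul_left u).integrableOn hU
      (hu.mul (contDiffOn_iteratedDeriv hU hψ (j + 1))).continuousOn
    -- The fundamental theorem for `u ψ^(j)` is one integration by parts; the induction hypothesis
    -- is then applied to `u'`.
    have hftc := (hψjc.mul_left u).integral_deriv hU ht' (hu.mul hψj)
    have hder : ∀ t ∈ U ∩ Iic t', deriv (fun t => u t * iteratedDeriv j ψ t) t =
        deriv u t * iteratedDeriv j ψ t + u t * iteratedDeriv (j + 1) ψ t := fun t ht =>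
      ((hasDerivAt_of_contDiffOn hU hu ht.1).mul (hasDerivAt_iteratedDeriv hU hψ j ht.1)).deriv
    rw [setIntegral_congr_fun (hU.measurableSet.inter measurableSet_Iic) hder,
      integral_add hI1 hI2, ih hu1] at hftc
    rw [← sub_eq_iff_eq_add'.2 hftc.symm, Finset.sum_range_succ']
    have hA : ∀ t, (-1 : 𝕜) ^ (j + 1) * iteratedDeriv (j + 1) u t * ψ t =
        -((-1) ^ j * iteratedDeriv j (deriv u) t * ψ t) := fun t => by
      rw [iteratedDeriv_succ']; ring
    have hB : ∀ s ∈ Finset.range j, (-1 : 𝕜) ^ (s + 1) * iteratedDeriv (s + 1) u t' *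
        iteratedDeriv (j + 1 - 1 - (s + 1)) ψ t' =
        -((-1) ^ s * iteratedDeriv s (deriv u) t' * iteratedDeriv (j - 1 - s) ψ t') := fun s _ => by
      rw [iteratedDeriv_succ', show j + 1 - 1 - (s + 1) = j - 1 - s by omega]; ring
    simp only [hA]
    rw [Finset.sum_congr rfl hB, integral_neg, Finset.sum_neg_distrib]
    simp
    ring

/-! ### Differentiation of Volterra integrals -/

section Volterra

variable {f : ℝ → ℝ → 𝕜}

/-- At the base point the interval has length zero, so varying the integrand contributes only to
second order: continuity of `f` suffices. -/
theorem hasDerivAt_integral_diag {τ₀ : ℝ} (hU : IsOpen U) (hτ₀ : τ₀ ∈ U)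
    (hf : ContinuousOn (fun p : ℝ × ℝ => f p.1 p.2) (U ×ˢ U)) :
    HasDerivAt (fun τ => ∫ t in τ₀..τ, f τ t) (f τ₀ τ₀) τ₀ := by
  obtain ⟨ε, hε, hεU⟩ := Metric.isOpen_iff.1 hU τ₀ hτ₀
  refine hasDerivAt_iff_isLittleO.2 (Asymptotics.isLittleO_iff.2 fun c hc => ?_)
  have hcont := hf.continuousAt ((hU.prod hU).mem_nhds (⟨hτ₀, hτ₀⟩ : (τ₀, τ₀) ∈ U ×ˢ U))
  obtain ⟨δ, hδ, hδc⟩ := Metric.continuousAt_iff.1 hcont c hc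
  filter_upwards [Metric.ball_mem_nhds τ₀ hδ, Metric.ball_mem_nhds τ₀ hε] with τ h1 h2
  have hsub : ∀ t ∈ uIcc τ₀ τ, dist t τ₀ ≤ dist τ τ₀ := fun t ht => by
    rw [Real.dist_eq, Real.dist_eq]
    exact abs_sub_left_of_mem_uIcc ht
  have hint : IntervalIntegrable (f τ) volume τ₀ τ := by
    refine ContinuousOn.intervalIntegrable (hf.comp (f := fun t => (τ, t))
      (by fun_prop) fun t ht => ⟨hεU h2, hεU ?_⟩)
    exact (hsub t ht).trans_lt h2
  have : (∫ t in τ₀..τ, f τ t) - (∫ t in τ₀..τ₀, f τ₀ t) - (τ - τ₀) • f τ₀ τ₀ =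
      ∫ t in τ₀..τ, (f τ t - f τ₀ τ₀) := by
    rw [intervalIntegral.integral_sub hint (by simp)]
    simp
  rw [this]
  refine intervalIntegral.norm_integral_le_of_norm_le_const fun t ht => ?_
  have := hδc (x := (τ, t)) (by
    rw [Prod.dist_eq]
    exact max_lt h1 ((hsub t (uIoc_subset_uIcc ht)).trans_lt h1))
  rw [dist_eq_norm] at this
  exact this.le

/-- Splitting the domain at `τ₀` separates two effects. The short interval from `τ₀` to `τ` gives
the diagonal term; over the fixed domain left of `τ₀` one differentiates under the integral sign. -/
theorem hasDerivAt_volterra (hU : IsOpen U) (hψ : ContinuousOn ψ U)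
    (hψc : ∀ t' ∈ U, LeftCompact U t' ψ)
    (hf : ContDiffOn ℝ ∞ (fun p : ℝ × ℝ => f p.1 p.2) (U ×ˢ U)) {τ₀ : ℝ} (hτ₀ : τ₀ ∈ U) :
    HasDerivAt (fun τ => ∫ t in U ∩ Iic τ, f τ t * ψ t)
      (f τ₀ τ₀ * ψ τ₀ + ∫ t in U ∩ Iic τ₀, deriv (fun s => f s t) τ₀ * ψ t) τ₀ := by
  obtain ⟨ε, hε, hεU⟩ := Metric.nhds_basis_closedBall.mem_iff.1 (hU.mem_nhds hτ₀)
  have hf' := contDiffOn_deriv_left hU hU hf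
  have hfψ : ContinuousOn (fun p : ℝ × ℝ => f p.1 p.2 * ψ p.2) (U ×ˢ U) :=
    hf.continuousOn.mul (hψ.comp continuousOn_snd fun p hp => hp.2)
  have hint : ∀ τ ∈ U, ∀ σ ∈ U, IntegrableOn (fun t => f τ t * ψ t) (U ∩ Iic σ) :=
    fun τ hτ σ hσ => ((hψc σ hσ).mul_left _).integrableOn hU
      ((contDiffOn_slice hf hτ).continuousOn.mul hψ)
  have hsplit : ∀ᶠ τ in 𝓝 τ₀, ∫ t in U ∩ Iic τ, f τ t * ψ t =
      (∫ t in τ₀..τ, f τ t * ψ t) + ∫ t in U ∩ Iic τ₀, f τ t * ψ t := by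
    filter_upwards [Metric.closedBall_mem_nhds τ₀ hε] with τ hτ
    have hi : ∀ σ ∈ U, IntegrableOn (U.indicator fun t => f τ t * ψ t) (Iic σ) := fun σ hσ => by
      rw [integrableOn_indicator_iff hU.measurableSet]
      exact hint τ (hεU hτ) σ hσ
    have h1 := intervalIntegral.integral_Iic_sub_Iic (hi τ₀ hτ₀) (hi τ (hεU hτ))
    rw [setIntegral_indicator hU.measurableSet, setIntegral_indicator hU.measurableSet,
      inter_comm, inter_comm _ U] at h1
    rw [← sub_eq_iff_eq_add, h1]
    refine intervalIntegral.integral_congr fun t ht => indicator_of_mem (hεU ?_) _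
    rw [Metric.mem_closedBall, Real.dist_eq]
    exact (abs_sub_left_of_mem_uIcc ht).trans hτ
  refine HasDerivAt.congr_of_eventuallyEq (HasDerivAt.add ?_ ?_) hsplit
  · exact hasDerivAt_integral_diag (f := fun τ t => f τ t * ψ t) hU hτ₀ hfψ
  · obtain ⟨K, hK, hKU, hKψ⟩ := hψc τ₀ hτ₀
    -- The dominating function is `M ‖ψ‖`: `M` bounds `∂f` on ball times `K`, and off `K` the factor
    -- `ψ` vanishes.
    obtain ⟨M, hM⟩ := ((isCompact_closedBall τ₀ ε).prod hK).exists_bound_of_continuousOn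
      (hf'.continuousOn.mono (prod_mono hεU hKU))
    have hmeas := hU.measurableSet.inter (measurableSet_Iic (a := τ₀))
    refine (hasDerivAt_integral_of_dominated_loc_of_deriv_le (s := Metric.closedBall τ₀ ε)
      (μ := volume.restrict (U ∩ Iic τ₀)) (F := fun τ t => f τ t * ψ t)
      (F' := fun τ t => deriv (fun s => f s t) τ * ψ t) (bound := fun t => M * ‖ψ t‖)
      (Metric.closedBall_mem_nhds τ₀ hε) ?_ (hint τ₀ hτ₀ τ₀ hτ₀) ?_ ?_ ?_ ?_).2
    · filter_upwards [hU.mem_nhds hτ₀] with τ hτ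
      exact (hint τ hτ τ₀ hτ₀).aestronglyMeasurable
    · exact (((hψc τ₀ hτ₀).mul_left _).integrableOn hU ((contDiffOn_slice
        (f := fun τ t => deriv (fun s => f s t) τ) hf' hτ₀).continuousOn.mul
        hψ)).aestronglyMeasurable
    · filter_upwards [ae_restrict_mem hmeas, ae_restrict_of_ae (Measure.ae_ne volume τ₀)]
        with t ht hne τ hτ
      by_cases htK : t ∈ K
      · rw [norm_mul]
        exact mul_le_mul_of_nonneg_right (hM (τ, t) ⟨hτ, htK⟩) (norm_nonneg _)
      · simp [hKψ t ht.1 (lt_of_le_of_ne ht.2 hne) htK]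
    · exact (((hψc τ₀ hτ₀).integrableOn hU hψ).norm.const_mul M)
    · filter_upwards [ae_restrict_mem hmeas] with t ht τ hτ
      have := hasDerivAt_left hU hU hf (hεU hτ) ht.1
      rw [← this.deriv] at this
      exact this.mul_const _

/-- The derivative is a smooth function plus a Volterra integral with kernel `∂f`, so induction on
the order works once `f` is allowed to vary. -/
theorem contDiffOn_volterra (hU : IsOpen U) (hψ : ContDiffOn ℝ ∞ ψ U)
    (hψc : ∀ t' ∈ U, LeftCompact U t' ψ)
    (hf : ContDiffOn ℝ ∞ (fun p : ℝ × ℝ => f p.1 p.2) (U ×ˢ U)) :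
    ContDiffOn ℝ ∞ (fun τ => ∫ t in U ∩ Iic τ, f τ t * ψ t) U := by
  refine contDiffOn_infty.2 fun n => ?_
  induction n generalizing f with
  | zero =>
    exact contDiffOn_zero.2 fun τ hτ =>
      (hasDerivAt_volterra hU hψ.continuousOn hψc hf hτ).continuousAt.continuousWithinAt
  | succ n ih =>
    push_cast
    refine (contDiffOn_succ_iff_deriv_of_isOpen hU).2 ⟨fun τ hτ => (hasDerivAt_volterra hU
      hψ.continuousOn hψc hf hτ).differentiableAt.differentiableWithinAt, by simp, ?_⟩
    refine ContDiffOn.congr ?_ fun τ hτ =>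
      (hasDerivAt_volterra hU hψ.continuousOn hψc hf hτ).deriv
    exact (((contDiffOn_diag hf).mul hψ).of_le (by exact_mod_cast le_top)).add
      (ih (f := fun τ t => deriv (fun s => f s t) τ) (contDiffOn_deriv_left hU hU hf))

/-- The iterated derivatives of a Volterra integral. -/
theorem iteratedDeriv_volterra (hU : IsOpen U) (hψ : ContDiffOn ℝ ∞ ψ U)
    (hψc : ∀ t' ∈ U, LeftCompact U t' ψ)
    (hf : ContDiffOn ℝ ∞ (fun p : ℝ × ℝ => f p.1 p.2) (U ×ˢ U)) (j : ℕ) {τ : ℝ} (hτ : τ ∈ U) :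
    iteratedDeriv j (fun τ => ∫ t in U ∩ Iic τ, f τ t * ψ t) τ =
      ∑ i ∈ Finset.range j,
        iteratedDeriv (j - 1 - i) (fun t => iteratedDeriv i (fun s => f s t) t * ψ t) τ +
      ∫ t in U ∩ Iic τ, iteratedDeriv j (fun s => f s t) τ * ψ t := by
  induction j generalizing τ with
  | zero => simp
  | succ j ih =>
    have hfj := fun i => contDiffOn_iteratedDeriv_left hU hU hf i
    have hd := fun i =>
      (contDiffOn_diag (f := fun τ t => iteratedDeriv i (fun s => f s t) τ) (hfj i)).mul hψ
    rw [iteratedDeriv_succ, EventuallyEq.deriv_eq (eventually_of_mem (hU.mem_nhds hτ) @ih)]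
    have h1 : HasDerivAt (fun τ => ∑ i ∈ Finset.range j,
        iteratedDeriv (j - 1 - i) (fun t => iteratedDeriv i (fun s => f s t) t * ψ t) τ)
        (∑ i ∈ Finset.range j,
        iteratedDeriv (j - 1 - i + 1) (fun t => iteratedDeriv i (fun s => f s t) t * ψ t) τ) τ :=
      HasDerivAt.fun_sum fun i _ => hasDerivAt_iteratedDeriv hU (hd i) _ hτ
    have h2 := hasDerivAt_volterra (f := fun τ t => iteratedDeriv j (fun s => f s t) τ) hU
      hψ.continuousOn hψc (hfj j) hτ
    rw [(h1.fun_add h2).deriv, Finset.sum_range_succ, ← add_assoc]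
    simp only [← iteratedDeriv_succ, Nat.add_sub_cancel, Nat.sub_self, iteratedDeriv_zero]
    congr 2
    refine Finset.sum_congr rfl fun i hi => ?_
    rw [show j - 1 - i + 1 = j - i by have := Finset.mem_range.1 hi; omega]

end Volterra

end IntegrationByParts

/-! ### The problem defining `x`: existence, smoothness, uniqueness -/

section CharacteristicProblem

variable {𝕜 : Type*} [RCLike 𝕜] {J U : Set ℝ} {n k : ℕ} {h : ℕ → ℝ → 𝕜}

theorem contDiffOn_det {ι : Type*} [Fintype ι] [DecidableEq ι] {M : ℝ → Matrix ι ι 𝕜}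
    (hM : ∀ i j, ContDiffOn ℝ ∞ (fun t => M t i j) J) : ContDiffOn ℝ ∞ (fun t => (M t).det) J := by
  simp only [Matrix.det_apply']
  exact ContDiffOn.sum fun σ _ => contDiffOn_const.mul (contDiffOn_prod fun i _ => hM _ _)

theorem iteratedDeriv_sum_const_mul {ι : Type*} [Fintype ι] (hJ : IsOpen J) {u : ι → ℝ → 𝕜}
    (hu : ∀ i, ContDiffOn ℝ ∞ (u i) J) (c : ι → 𝕜) (m : ℕ) {t : ℝ} (ht : t ∈ J) :
    iteratedDeriv m (fun s => ∑ i, c i * u i s) t = ∑ i, c i * iteratedDeriv m (u i) t := by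
  rw [iteratedDeriv_fun_sum fun i _ => contDiffAt_const.mul (contDiffAt_of_mem hJ (hu i) ht m)]
  exact Finset.sum_congr rfl fun i _ => iteratedDeriv_const_mul_field _ _

/-- A fundamental system of a scalar linear equation whose Wronskian has no zero. -/
theorem exists_fundamental_system (hJ : IsOpen J) (hJc : J.OrdConnected)
    (hh : ∀ m ≤ n + 1, ContDiffOn ℝ ∞ (h m) J) (hh0 : ∀ t ∈ J, h (n + 1) t ≠ 0) :
    ∃ u : Fin (n + 1) → ℝ → 𝕜, (∀ i, ContDiffOn ℝ ∞ (u i) J) ∧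
      (∀ i, ∀ t ∈ J, ∑ m ∈ Finset.range (n + 2), h m t * iteratedDeriv m (u i) t = 0) ∧
      ∀ t ∈ J, (Matrix.of fun m i : Fin (n + 1) => iteratedDeriv m (u i) t).det ≠ 0 := by
  rcases J.eq_empty_or_nonempty with rfl | ⟨t₀, ht₀⟩
  · exact ⟨0, by simp [ContDiffOn]⟩
  choose u hu hueq hu0 using fun i : Fin (n + 1) => exists_solution_linear_equation
    (χ := fun _ => 0) hJ hJc ht₀ hh hh0 contDiffOn_const (Pi.single i (1 : 𝕜))
  refine ⟨u, hu, hueq, fun t ht hdet => ?_⟩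
  -- A kernel vector of the Wronskian matrix at `t` gives a combination with zero jet at `t`, hence
  -- identically zero. At `t₀` the jets are the standard basis, so the vector is zero.
  obtain ⟨c, hc, hWc⟩ := Matrix.exists_mulVec_eq_zero_iff.2 hdet
  have hsum : ContDiffOn ℝ ∞ (fun s => ∑ i, c i * u i s) J :=
    ContDiffOn.sum fun i _ => contDiffOn_const.mul (hu i)
  have hz := eqOn_of_linear_equation (u := fun s => ∑ i, c i * u i s) (v := fun _ => 0)
    (χ := fun _ => 0) hJ hJc ht hh hh0 hsum
    (fun s hs => by
      simp only [iteratedDeriv_sum_const_mul hJ hu c _ hs, Finset.mul_sum]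
      rw [Finset.sum_comm]
      refine Finset.sum_eq_zero fun i _ => ?_
      rw [← mul_zero (c i), ← hueq i s hs, Finset.mul_sum]
      exact Finset.sum_congr rfl fun m _ => by ring)
    contDiffOn_const (fun s _ => by simp)
    (fun m hm => by
      rw [iteratedDeriv_sum_const_mul hJ hu c _ ht]
      have := congrFun hWc ⟨m, by omega⟩
      simp only [Matrix.mulVec, dotProduct, Matrix.of_apply, Pi.zero_apply] at this
      simpa [mul_comm] using this)
  refine hc (funext fun i => ?_)
  have h1 := (hz.iteratedDeriv_of_isOpen hJ i) ht₀
  rw [iteratedDeriv_sum_const_mul hJ hu c _ ht₀] at h1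
  simpa [hu0, Pi.single_apply] using h1

/-- Existence of a smooth solution of the characteristic problem on an open interval. -/
theorem exists_isSolution_of_ordConnected (hk : 0 < k) (hJ : IsOpen J) (hJc : J.OrdConnected)
    (hh : ∀ m ≤ k, ContDiffOn ℝ ∞ (h m) J) (hh0 : ∀ t ∈ J, h k t ≠ 0) :
    ∃ x : ℝ → ℝ → 𝕜, IsSolution J k h x ∧
      ContDiffOn ℝ ∞ (fun p : ℝ × ℝ => x p.1 p.2) (J ×ˢ J) := by
  obtain ⟨n, rfl⟩ := Nat.exists_eq_succ_of_ne_zero hk.ne'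
  obtain ⟨u, hu, hueq, hdet⟩ := exists_fundamental_system hJ hJc hh hh0
  let W : ℝ → Matrix (Fin (n + 1)) (Fin (n + 1)) 𝕜 := fun t =>
    Matrix.of fun m i => iteratedDeriv m (u i) t
  -- `b t'` is the jet prescribed on the diagonal. Cramer's rule for the coefficients `c` makes
  -- their smooth dependence on `t'` visible.
  let b : ℝ → Fin (n + 1) → 𝕜 := fun t => Pi.single (Fin.last n) (-(h (n + 1) t)⁻¹)
  let c : Fin (n + 1) → ℝ → 𝕜 := fun i t => Matrix.cramer (W t) (b t) i / (W t).det
  have hW : ∀ i j, ContDiffOn ℝ ∞ (fun t => W t i j) J := fun i j =>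
    contDiffOn_iteratedDeriv hJ (hu j) i
  have hb : ∀ i, ContDiffOn ℝ ∞ (fun t => b t i) J := fun i => by
    by_cases hi : i = Fin.last n
    · subst hi
      simp only [b, Pi.single_eq_same]
      exact ((hh _ le_rfl).inv hh0).neg
    · simp only [b, Pi.single_eq_of_ne hi]
      exact contDiffOn_const
  have hc : ∀ i, ContDiffOn ℝ ∞ (c i) J := fun i => by
    refine contDiffOn_div ?_ (contDiffOn_det hW) hdet
    simp only [Matrix.cramer_apply]
    refine contDiffOn_det fun l j => ?_
    simp only [Matrix.updateCol_apply]
    split_ifs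
    · exact hb l
    · exact hW l j
  have hjet : ∀ t ∈ J, ∀ m : Fin (n + 1),
      iteratedDeriv m (fun s => ∑ i, c i t * u i s) t = b t m := fun t ht m => by
    rw [iteratedDeriv_sum_const_mul hJ hu _ _ ht]
    have h1 := congrFun (Matrix.mulVec_cramer (W t) (b t)) m
    simp only [Matrix.mulVec, dotProduct, Pi.smul_apply, smul_eq_mul] at h1
    rw [← mul_div_cancel_left₀ (b t m) (hdet t ht)]
    change _ = (W t).det * b t m / (W t).det
    rw [← h1, Finset.sum_div]
    refine Finset.sum_congr rfl fun i _ => ?_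
    simp only [c, W, Matrix.of_apply]
    ring
  refine ⟨fun t' t => ∑ i, c i t' * u i t, fun t' ht' => ⟨?_, fun t ht => ?_, ?_, fun j hj => ?_⟩,
    ?_⟩
  · exact ContDiffOn.sum fun i _ => contDiffOn_const.mul (hu i)
  · simp only [iteratedDeriv_sum_const_mul hJ hu _ _ ht, Finset.mul_sum]
    rw [Finset.sum_comm]
    refine Finset.sum_eq_zero fun i _ => ?_
    rw [← mul_zero (c i t'), ← hueq i t ht, Finset.mul_sum]
    exact Finset.sum_congr rfl fun m _ => by ring
  · simpa [b] using hjet t' ht' (Fin.last n)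
  · have := hjet t' ht' ⟨j, by omega⟩
    rwa [show b t' ⟨j, by omega⟩ = 0 from
      Pi.single_eq_of_ne (fun h => by simp [Fin.ext_iff] at h; omega) _] at this
  · exact ContDiffOn.sum fun i _ => ((hc i).comp contDiffOn_fst fun p hp => hp.1).mul
      ((hu i).comp contDiffOn_snd fun p hp => hp.2)

/-- Uniqueness for the characteristic problem on an open interval. -/
theorem IsSolution.unique (hk : 0 < k) (hJ : IsOpen J) (hJc : J.OrdConnected)
    (hh : ∀ m ≤ k, ContDiffOn ℝ ∞ (h m) J) (hh0 : ∀ t ∈ J, h k t ≠ 0) {x y : ℝ → ℝ → 𝕜}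
    (hx : IsSolution J k h x) (hy : IsSolution J k h y) {t' t : ℝ} (ht' : t' ∈ J) (ht : t ∈ J) :
    x t' t = y t' t := by
  obtain ⟨n, rfl⟩ := Nat.exists_eq_succ_of_ne_zero hk.ne'
  obtain ⟨hx1, hx2, hx3, hx4⟩ := hx t' ht'
  obtain ⟨hy1, hy2, hy3, hy4⟩ := hy t' ht'
  refine eqOn_of_linear_equation (χ := fun _ => 0) hJ hJc ht' hh hh0 hx1 hx2 hy1 hy2
    (fun i hi => ?_) ht
  rcases hi.eq_or_lt with rfl | hi
  · exact hx3.trans hy3.symm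
  · rw [hx4 i (by simpa using hi), hy4 i (by simpa using hi)]

theorem IsSolution.mono {x : ℝ → ℝ → 𝕜} (hx : IsSolution U k h x) (hJU : J ⊆ U) :
    IsSolution J k h x := fun t' ht' =>
  have h1 := hx t' (hJU ht')
  ⟨h1.1.mono hJU, fun t ht => h1.2.1 t (hJU ht), h1.2.2⟩

/-- Existence of a smooth solution of the characteristic problem on an open set. -/
theorem exists_isSolution (hk : 0 < k) (hU : IsOpen U)
    (hh : ∀ m ≤ k, ContDiffOn ℝ ∞ (h m) U) (hh0 : ∀ t ∈ U, h k t ≠ 0) :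
    ∃ x : ℝ → ℝ → 𝕜, IsSolution U k h x ∧
      ContDiffOn ℝ ∞ (fun p : ℝ × ℝ => x p.1 p.2) (U ×ˢ U) := by
  classical
  -- The problem is solved on each component of `U`, and `x` is set to zero when `t` and `t'` lie in
  -- different components, where only the homogeneous equation is required.
  let C : ℝ → Set ℝ := connectedComponentIn U
  have hCU : ∀ t, C t ⊆ U := fun t => connectedComponentIn_subset U t
  have hCo : ∀ t, IsOpen (C t) := fun t => hU.connectedComponentIn
  have hCm : ∀ t ∈ U, t ∈ C t := fun t ht => mem_connectedComponentIn ht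
  have hCe : ∀ s t, s ∈ C t → C s = C t := fun s t hs => (connectedComponentIn_eq hs).symm
  -- The solution is chosen per set rather than per point: all `t'` in one component must share it
  -- for `x` to be smooth in `t'`.
  have hex : ∀ S : Set ℝ, ∃ x : ℝ → ℝ → 𝕜, (∃ t, S = C t) → IsSolution S k h x ∧
      ContDiffOn ℝ ∞ (fun p : ℝ × ℝ => x p.1 p.2) (S ×ˢ S) := by
    intro S
    by_cases hS : ∃ t, S = C t
    · obtain ⟨t, rfl⟩ := hS
      obtain ⟨x, hx⟩ := exists_isSolution_of_ordConnected (h := h) hk (hCo t)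
        isPreconnected_connectedComponentIn.ordConnected (fun m hm => (hh m hm).mono (hCU t))
        (fun s hs => hh0 s (hCU t hs))
      exact ⟨x, fun _ => hx⟩
    · exact ⟨0, fun h => absurd h hS⟩
  choose X hX using hex
  let x : ℝ → ℝ → 𝕜 := fun t' t => if t ∈ C t' then X (C t') t' t else 0
  have hin : ∀ t' t, t ∈ C t' → x t' =ᶠ[𝓝 t] X (C t') t' := fun t' t ht => by
    filter_upwards [(hCo t').mem_nhds ht] with s hs using if_pos hs
  have hdisj : ∀ t' t s, t ∉ C t' → s ∈ C t → s ∉ C t' := fun t' t s ht hs hs' => by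
    have h2 := (hCe s t hs).symm.trans (hCe s t' hs')
    have htU : t ∈ U := by
      by_contra htU
      have : C t = ∅ := connectedComponentIn_eq_empty htU
      simp [this] at hs
    exact ht (h2 ▸ hCm t htU)
  have hout : ∀ t' t, t ∈ U → t ∉ C t' → x t' =ᶠ[𝓝 t] fun _ => 0 := fun t' t htU ht => by
    filter_upwards [(hCo t).mem_nhds (hCm t htU)] with s hs using if_neg (hdisj t' t s ht hs)
  refine ⟨x, fun t' ht' => ?_, fun p hp => ?_⟩
  · obtain ⟨h1, h2, h3, h4⟩ := (hX (C t') ⟨t', rfl⟩).1 t' (hCm t' ht')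
    have hnear := hin t' t' (hCm t' ht')
    refine ⟨fun t ht => ?_, fun t ht => ?_, ?_, fun j hj => ?_⟩
    · by_cases htC : t ∈ C t'
      · exact ((h1.contDiffAt ((hCo t').mem_nhds htC)).congr_of_eventuallyEq
          (hin t' t htC)).contDiffWithinAt
      · exact (contDiffAt_const.congr_of_eventuallyEq (hout t' t ht htC)).contDiffWithinAt
    · by_cases htC : t ∈ C t'
      · simp only [(hin t' t htC).iteratedDeriv_eq]
        exact h2 t htC
      · simp [(hout t' t ht htC).iteratedDeriv_eq]
    · rw [hnear.iteratedDeriv_eq, h3]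
    · rw [hnear.iteratedDeriv_eq, h4 j hj]
  · obtain ⟨s, t⟩ := p
    have hopen := ((hCo s).prod (hCo t)).mem_nhds
      (⟨hCm s hp.1, hCm t hp.2⟩ : (s, t) ∈ C s ×ˢ C t)
    refine ContDiffAt.contDiffWithinAt ?_
    by_cases htC : t ∈ C s
    · have hCC : C t = C s := hCe t s htC
      have h5 := (hX (C s) ⟨s, rfl⟩).2.contDiffAt (x := (s, t))
        (((hCo s).prod (hCo s)).mem_nhds ⟨hCm s hp.1, htC⟩)
      refine h5.congr_of_eventuallyEq ?_
      filter_upwards [hopen] with q hq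
      have hq1 : C q.1 = C s := hCe _ _ hq.1
      have hq2 : q.2 ∈ C q.1 := by rw [hq1, ← hCC]; exact hq.2
      simp only [x, if_pos hq2, hq1]
    · refine contDiffAt_const (c := (0 : 𝕜)).congr_of_eventuallyEq ?_
      filter_upwards [hopen] with q hq
      have hq1 : C q.1 = C s := hCe _ _ hq.1
      exact if_neg (by rw [hq1]; exact hdisj s t q.2 htC hq.2)

end CharacteristicProblem

/-! ### The differential operator `L ∗ f`, its adjoint, and `x ∗ L` -/

section StarOperator

variable {𝕜 : Type*} [RCLike 𝕜] {D J : Set ℝ} {k : ℕ} {f : ℝ → ℝ → 𝕜} {g : ℕ → ℝ → 𝕜}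
  {t t' : ℝ} {ψ : ℝ → 𝕜}

/-- The Leibniz rule with a summation range independent of the order. -/
theorem iteratedDeriv_mul_eq_sum_range (hD : IsOpen D) {a b : ℝ → 𝕜} (ha : ContDiffOn ℝ ∞ a D)
    (hb : ContDiffOn ℝ ∞ b D) (ht : t ∈ D) {l N : ℕ} (hl : l < N) :
    iteratedDeriv l (fun s => a s * b s) t =
      ∑ m ∈ Finset.range N, (l.choose m : 𝕜) * iteratedDeriv m a t * iteratedDeriv (l - m) b t := by
  rw [iteratedDeriv_fun_mul (contDiffAt_of_mem hD ha ht l) (contDiffAt_of_mem hD hb ht l)]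
  refine Finset.sum_subset (Finset.range_subset_range.2 hl) fun m _ hm => ?_
  rw [Nat.choose_eq_zero_of_lt (by simpa using hm)]
  simp

theorem diffDist_apply (t : ℝ) (φ : ℝ → 𝕜) :
    diffDist k g t φ = ∑ j ∈ Finset.range (k + 2), g j t * iteratedDeriv j φ t := by
  simp [diffDist, lmul, delta, Finset.sum_apply]

/-- The value `f^{(i,0)}(t, t)`. -/
noncomputable def diagDeriv (f : ℝ → ℝ → 𝕜) (i : ℕ) (t : ℝ) : 𝕜 :=
  iteratedDeriv i (fun s => f s t) t

theorem contDiffOn_diagDeriv (hD : IsOpen D)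
    (hf : ContDiffOn ℝ ∞ (fun p : ℝ × ℝ => f p.1 p.2) (D ×ˢ D)) (i : ℕ) :
    ContDiffOn ℝ ∞ (diagDeriv f i) D :=
  contDiffOn_diag (f := fun τ t => iteratedDeriv i (fun s => f s t) τ)
    (contDiffOn_iteratedDeriv_left hD hD hf i)

/-- The differential operator `L ∗ f`, for a kernel `f(t', t) Θ(t' - t)` annihilated by `L`. -/
noncomputable def starOp (k : ℕ) (f : ℝ → ℝ → 𝕜) (g : ℕ → ℝ → 𝕜) (ψ : ℝ → 𝕜) (t : ℝ) : 𝕜 :=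
  ∑ j ∈ Finset.range (k + 2), ∑ l ∈ Finset.range j,
    g j t * iteratedDeriv l (fun s => diagDeriv f (j - 1 - l) s * ψ s) t

/-- In the `j`-th derivative of the Volterra integral, the remaining integral has kernel
`f^{(j,0)}`; summed against `g_j` these kernels vanish by `hL`, and only diagonal terms survive. -/
theorem diffDist_theta (hD : IsOpen D)
    (hf : ContDiffOn ℝ ∞ (fun p : ℝ × ℝ => f p.1 p.2) (D ×ˢ D))
    (hL : ∀ t' ∈ D, ∀ t ∈ D,
      ∑ j ∈ Finset.range (k + 2), g j t' * iteratedDeriv j (fun s => f s t) t' = 0)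
    (hψ : ContDiffOn ℝ ∞ ψ D) (hψc : ∀ t' ∈ D, LeftCompact D t' ψ) (ht : t ∈ D) :
    diffDist k g t (fun s => theta D f s ψ) = starOp k f g ψ t := by
  have hint : ∀ j, IntegrableOn (fun s => g j t * (iteratedDeriv j (fun r => f r s) t * ψ s))
      (D ∩ Iic t) := fun j =>
    (((hψc t ht).mul_left _).integrableOn hD ((contDiffOn_slice
      (f := fun τ t => iteratedDeriv j (fun s => f s t) τ)
      (contDiffOn_iteratedDeriv_left hD hD hf j) ht).continuousOn.mul hψ.continuousOn)).const_mul _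
  have hz : ∑ j ∈ Finset.range (k + 2),
      g j t * ∫ s in D ∩ Iic t, iteratedDeriv j (fun r => f r s) t * ψ s = 0 := by
    simp only [← integral_const_mul]
    rw [← integral_finsetSum _ fun j _ => hint j]
    refine setIntegral_eq_zero_of_forall_eq_zero fun s hs => ?_
    simp only [← mul_assoc]
    rw [← Finset.sum_mul, hL t ht s hs.1, zero_mul]
  rw [diffDist_apply]
  unfold theta
  simp only [iteratedDeriv_volterra hD hψ hψc hf _ ht, mul_add]
  rw [Finset.sum_add_distrib, hz, add_zero]
  refine Finset.sum_congr rfl fun j _ => ?_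
  rw [Finset.mul_sum, ← Finset.sum_range_reflect]
  refine Finset.sum_congr rfl fun l hl => ?_
  rw [show j - 1 - (j - 1 - l) = l by have := Finset.mem_range.1 hl; omega]
  rfl

/-- The coefficients of `starOp`. -/
noncomputable def starCoeff (k : ℕ) (f : ℝ → ℝ → 𝕜) (g : ℕ → ℝ → 𝕜) (m : ℕ) (t : ℝ) : 𝕜 :=
  ∑ j ∈ Finset.range (k + 2), ∑ l ∈ Finset.range j,
    (l.choose m : 𝕜) * (g j t * iteratedDeriv (l - m) (diagDeriv f (j - 1 - l)) t)

theorem contDiffOn_starCoeff (hD : IsOpen D)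
    (hf : ContDiffOn ℝ ∞ (fun p : ℝ × ℝ => f p.1 p.2) (D ×ˢ D))
    (hg : ∀ j ≤ k + 1, ContDiffOn ℝ ∞ (g j) D) (m : ℕ) :
    ContDiffOn ℝ ∞ (starCoeff k f g m) D :=
  ContDiffOn.sum fun j hj => ContDiffOn.sum fun l _ => contDiffOn_const.mul
    ((hg j (by have := Finset.mem_range.1 hj; omega)).mul
      (contDiffOn_iteratedDeriv hD (contDiffOn_diagDeriv hD hf _) _))

theorem starOp_eq_sum (hD : IsOpen D)
    (hf : ContDiffOn ℝ ∞ (fun p : ℝ × ℝ => f p.1 p.2) (D ×ˢ D)) (hψ : ContDiffOn ℝ ∞ ψ D)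
    (ht : t ∈ D) :
    starOp k f g ψ t = ∑ m ∈ Finset.range (k + 1), starCoeff k f g m t * iteratedDeriv m ψ t := by
  simp only [starCoeff, starOp, Finset.sum_mul]
  rw [Finset.sum_comm]
  refine Finset.sum_congr rfl fun j hj => ?_
  rw [Finset.sum_comm]
  refine Finset.sum_congr rfl fun l hl => ?_
  have hlk : l < k + 1 := by
    have := Finset.mem_range.1 hj
    have := Finset.mem_range.1 hl
    omega
  simp only [mul_comm (diagDeriv f _ _)]
  rw [iteratedDeriv_mul_eq_sum_range hD hψ (contDiffOn_diagDeriv hD hf _) ht hlk, Finset.mul_sum]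
  exact Finset.sum_congr rfl fun m _ => by ring

/-- Only the last term of the double sum has `l = k`. -/
theorem sum_sum_range_eq_last {M : Type*} [AddCommMonoid M] (F : ℕ → ℕ → M)
    (hF : ∀ j l, j ≤ k + 1 → l < j → l < k → F j l = 0) :
    ∑ j ∈ Finset.range (k + 2), ∑ l ∈ Finset.range j, F j l = F (k + 1) k := by
  rw [Finset.sum_range_succ, Finset.sum_eq_zero, zero_add, Finset.sum_range_succ,
    Finset.sum_eq_zero, zero_add]
  · intro l hl
    have := Finset.mem_range.1 hl
    exact hF _ _ le_rfl (by omega) this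
  · intro j hj
    refine Finset.sum_eq_zero fun l hl => ?_
    have := Finset.mem_range.1 hj
    have := Finset.mem_range.1 hl
    exact hF _ _ (by omega) (by omega) (by omega)

theorem starCoeff_top (t : ℝ) : starCoeff k f g k t = g (k + 1) t * f t t := by
  rw [starCoeff, sum_sum_range_eq_last]
  · simp [diagDeriv]
  · intro j l _ _ hl
    simp [Nat.choose_eq_zero_of_lt hl]

/-- The added terms have `l < m` and a vanishing binomial coefficient. Ranges that do not depend on
`m` allow the sums to be interchanged. -/
theorem hCoeff_eq (m : ℕ) (t : ℝ) :
    hCoeff k f g m t = ∑ j ∈ Finset.range (k + 2), ∑ l ∈ Finset.range j,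
      (l.choose m : 𝕜) * (-1) ^ l * diagDeriv f (j - 1 - l) t * iteratedDeriv (l - m) (g j) t := by
  have hsub : Finset.Icc (m + 1) (k + 1) ⊆ Finset.range (k + 2) := fun j hj => by
    have := Finset.mem_Icc.1 hj
    exact Finset.mem_range.2 (by omega)
  rw [hCoeff, ← Finset.sum_subset hsub]
  · refine Finset.sum_congr rfl fun j hj => ?_
    have hj' := Finset.mem_Icc.1 hj
    have hsub' : Finset.Icc m (j - 1) ⊆ Finset.range j := fun l hl => by
      have := Finset.mem_Icc.1 hl
      exact Finset.mem_range.2 (by omega)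
    rw [← Finset.sum_subset hsub']
    · refine Finset.sum_congr rfl fun l _ => ?_
      rw [diagDeriv, Nat.sub_right_comm]
    · intro l hl hl'
      have := Finset.mem_range.1 hl
      rw [Finset.mem_Icc] at hl'
      rw [Nat.choose_eq_zero_of_lt (by omega)]
      simp
  · intro j hj hj'
    refine Finset.sum_eq_zero fun l hl => ?_
    have := Finset.mem_range.1 hl
    have := Finset.mem_range.1 hj
    rw [Finset.mem_Icc] at hj'
    rw [Nat.choose_eq_zero_of_lt (by omega)]
    simp

theorem contDiffOn_hCoeff (hD : IsOpen D)
    (hf : ContDiffOn ℝ ∞ (fun p : ℝ × ℝ => f p.1 p.2) (D ×ˢ D))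
    (hg : ∀ j ≤ k + 1, ContDiffOn ℝ ∞ (g j) D) (m : ℕ) :
    ContDiffOn ℝ ∞ (hCoeff k f g m) D := by
  refine ContDiffOn.congr ?_ fun t _ => hCoeff_eq m t
  exact ContDiffOn.sum fun j hj => ContDiffOn.sum fun l _ =>
    (contDiffOn_const.mul (contDiffOn_diagDeriv hD hf _)).mul
      (contDiffOn_iteratedDeriv hD (hg j (by have := Finset.mem_range.1 hj; omega)) _)

/-- This is the leading coefficient of `L ∗ f` up to the sign of the adjoint, so the equation for
`x` is regular on `U`. -/
theorem hCoeff_top (t : ℝ) : hCoeff k f g k t = (-1) ^ k * f t t * g (k + 1) t := by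
  simp [hCoeff]

/-- The formal adjoint of `starOp`. -/
theorem sum_adjoint_eq (hD : IsOpen D) (hg : ∀ j ≤ k + 1, ContDiffOn ℝ ∞ (g j) D) {u : ℝ → 𝕜}
    (hu : ContDiffOn ℝ ∞ u D) (ht : t ∈ D) :
    ∑ j ∈ Finset.range (k + 2), ∑ l ∈ Finset.range j,
      (-1) ^ l * iteratedDeriv l (fun s => u s * g j s) t * diagDeriv f (j - 1 - l) t =
    ∑ m ∈ Finset.range (k + 1), hCoeff k f g m t * iteratedDeriv m u t := by
  simp only [hCoeff_eq, Finset.sum_mul]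
  rw [Finset.sum_comm (s := Finset.range (k + 1))]
  refine Finset.sum_congr rfl fun j hj => ?_
  rw [Finset.sum_comm]
  refine Finset.sum_congr rfl fun l hl => ?_
  have hj' := Finset.mem_range.1 hj
  have hl' := Finset.mem_range.1 hl
  rw [iteratedDeriv_mul_eq_sum_range hD hu (hg j (by omega)) ht (show l < k + 1 by omega),
    Finset.mul_sum, Finset.sum_mul]
  exact Finset.sum_congr rfl fun m _ => by ring

/-- The low-order derivatives of `u g` at a point where the jet of `u` is concentrated in
order `k - 1`. -/
theorem iteratedDeriv_mul_of_jet (hD : IsOpen D) {u a : ℝ → 𝕜} (hu : ContDiffOn ℝ ∞ u D)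
    (ha : ContDiffOn ℝ ∞ a D) (ht : t ∈ D) {s : ℕ} (h0 : ∀ i < s, iteratedDeriv i u t = 0) :
    iteratedDeriv s (fun r => u r * a r) t = iteratedDeriv s u t * a t := by
  rw [iteratedDeriv_mul_eq_sum_range hD hu ha ht (Nat.lt_succ_self s), Finset.sum_range_succ,
    Finset.sum_eq_zero]
  · simp
  · intro i hi
    simp [h0 i (Finset.mem_range.1 hi)]

/-- `x ∗ (L ∗ f) = δ`, in terms of the differential operator `L ∗ f`. -/
theorem integral_mul_starOp (hk : 0 < k) (hD : IsOpen D)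
    (hf : ContDiffOn ℝ ∞ (fun p : ℝ × ℝ => f p.1 p.2) (D ×ˢ D))
    (hg : ∀ j ≤ k + 1, ContDiffOn ℝ ∞ (g j) D) (ht' : t' ∈ D) (h0 : f t' t' * g (k + 1) t' ≠ 0)
    {x : ℝ → ℝ → 𝕜} (hx : IsSolution D k (hCoeff k f g) x)
    (hψ : ContDiffOn ℝ ∞ ψ D) (hψc : LeftCompact D t' ψ) :
    ∫ t in D ∩ Iic t', x t' t * starOp k f g ψ t = ψ t' := by
  obtain ⟨hu, hode, hjet, hjet0⟩ := hx t' ht'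
  have hrg : ∀ {j}, j ∈ Finset.range (k + 2) → j ≤ k + 1 := fun hj => by
    have := Finset.mem_range.1 hj
    omega
  have ha := contDiffOn_diagDeriv hD hf
  have hug : ∀ j ∈ Finset.range (k + 2), ContDiffOn ℝ ∞ (fun t => x t' t * g j t) D :=
    fun j hj => hu.mul (hg j (hrg hj))
  have hI : ∀ j ∈ Finset.range (k + 2), ∀ l, IntegrableOn (fun t => x t' t * g j t *
      iteratedDeriv l (fun s => diagDeriv f (j - 1 - l) s * ψ s) t) (D ∩ Iic t') := fun j hj l =>
    (((hψc.mul_left _).iterate_deriv hD l).mul_left _).integrableOn hD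
      ((hug j hj).mul (contDiffOn_iteratedDeriv hD ((ha _).mul hψ) l)).continuousOn
  have hI' : ∀ j ∈ Finset.range (k + 2), ∀ l, IntegrableOn (fun t => (-1) ^ l *
      iteratedDeriv l (fun s => x t' s * g j s) t * (diagDeriv f (j - 1 - l) t * ψ t))
      (D ∩ Iic t') := fun j hj l =>
    ((hψc.mul_left _).mul_left _).integrableOn hD ((contDiffOn_const.mul
      (contDiffOn_iteratedDeriv hD (hug j hj) l)).mul ((ha _).mul hψ)).continuousOn
  -- The integrals left after integration by parts add up to the adjoint operator applied to `x`,
  -- integrated against `ψ`.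
  have hadj : ∑ j ∈ Finset.range (k + 2), ∑ l ∈ Finset.range j, ∫ t in D ∩ Iic t', (-1) ^ l *
      iteratedDeriv l (fun s => x t' s * g j s) t * (diagDeriv f (j - 1 - l) t * ψ t) = 0 := by
    rw [Finset.sum_congr rfl fun j hj => (integral_finsetSum _ fun l _ => hI' j hj l).symm,
      ← integral_finsetSum _ fun j hj => integrable_finsetSum _ fun l _ => hI' j hj l]
    refine setIntegral_eq_zero_of_forall_eq_zero fun t ht => ?_
    simp only [← mul_assoc, ← Finset.sum_mul]
    rw [sum_adjoint_eq hD hg hu ht.1, hode t ht.1, zero_mul]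
  have hlhs : ∫ t in D ∩ Iic t', x t' t * starOp k f g ψ t =
      ∑ j ∈ Finset.range (k + 2), ∑ l ∈ Finset.range j, ∫ t in D ∩ Iic t', x t' t * g j t *
        iteratedDeriv l (fun s => diagDeriv f (j - 1 - l) s * ψ s) t := by
    rw [Finset.sum_congr rfl fun j hj => (integral_finsetSum _ fun l _ => hI j hj l).symm,
      ← integral_finsetSum _ fun j hj => integrable_finsetSum _ fun l _ => hI j hj l]
    simp only [starOp, Finset.mul_sum, mul_assoc]
  have hibp : ∀ j ∈ Finset.range (k + 2), ∀ l, ∫ t in D ∩ Iic t', x t' t * g j t *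
        iteratedDeriv l (fun s => diagDeriv f (j - 1 - l) s * ψ s) t = _ := fun j hj l =>
    (hψc.mul_left (diagDeriv f (j - 1 - l))).integral_mul_iteratedDeriv hD ht' ((ha _).mul hψ)
      (hug j hj) l
  rw [hlhs, Finset.sum_congr rfl fun j hj => Finset.sum_congr rfl fun l _ => hibp j hj l]
  simp only [Finset.sum_add_distrib]
  rw [hadj, add_zero]
  have hlow : ∀ j ≤ k + 1, ∀ s, s + 1 < k → iteratedDeriv s (fun r => x t' r * g j r) t' = 0 :=
    fun j hj s hs => by
      rw [iteratedDeriv_mul_of_jet hD hu (hg j hj) ht' fun i hi => hjet0 i (by omega),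
        hjet0 s hs, zero_mul]
  -- A boundary term contains a derivative of `x g_j` of order `s < l ≤ k`, and orders below `k - 1`
  -- vanish. Only `j = k + 1`, `l = k`, `s = k - 1` remains; there the signs `(-1)^(k-1)`, `-1` and
  -- that of `h_k` cancel and leave `ψ t'`.
  rw [sum_sum_range_eq_last]
  · obtain ⟨n, rfl⟩ := Nat.exists_eq_succ_of_ne_zero hk.ne'
    rw [Finset.sum_range_succ, Finset.sum_eq_zero, zero_add,
      iteratedDeriv_mul_of_jet hD hu (hg _ le_rfl) ht' fun i hi => hjet0 i (by omega)]
    · simp only [Nat.succ_eq_add_one, Nat.add_sub_cancel] at hjet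
      rw [hjet, hCoeff_top]
      have h1 : f t' t' ≠ 0 := left_ne_zero_of_mul h0
      have h2 : g (n + 1 + 1) t' ≠ 0 := right_ne_zero_of_mul h0
      simp only [Nat.succ_eq_add_one, Nat.add_sub_cancel, Nat.sub_self, iteratedDeriv_zero,
        diagDeriv]
      field_simp
      ring
    · intro s hs
      rw [hlow _ le_rfl s (by have := Finset.mem_range.1 hs; omega)]
      simp
  · intro j l hj hlj hlk
    refine Finset.sum_eq_zero fun s hs => ?_
    rw [hlow j hj s (by have := Finset.mem_range.1 hs; omega)]
    simp

/-- `x ∗ L` in normal form. -/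
theorem theta_diffDist (hD : IsOpen D) (hg : ∀ j ≤ k + 1, ContDiffOn ℝ ∞ (g j) D) (ht' : t' ∈ D)
    {x : ℝ → ℝ → 𝕜} (hx : ContDiffOn ℝ ∞ (x t') D)
    (hψ : ContDiffOn ℝ ∞ ψ D) (hψc : LeftCompact D t' ψ) :
    theta D x t' (fun τ => diffDist k g τ ψ) = invDist D k g x t' ψ := by
  have hrg : ∀ {j}, j ∈ Finset.range (k + 2) → j ≤ k + 1 := fun hj => by
    have := Finset.mem_range.1 hj
    omega
  have hug : ∀ j ∈ Finset.range (k + 2), ContDiffOn ℝ ∞ (fun t => x t' t * g j t) D :=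
    fun j hj => hx.mul (hg j (hrg hj))
  have hI : ∀ j ∈ Finset.range (k + 2), IntegrableOn (fun t => x t' t * g j t *
      iteratedDeriv j ψ t) (D ∩ Iic t') := fun j hj =>
    ((hψc.iterate_deriv hD j).mul_left _).integrableOn hD
      ((hug j hj).mul (contDiffOn_iteratedDeriv hD hψ j)).continuousOn
  have hI' : ∀ j ∈ Finset.range (k + 2), IntegrableOn (fun t => (-1) ^ j *
      iteratedDeriv j (fun s => x t' s * g j s) t * ψ t) (D ∩ Iic t') := fun j hj =>
    (hψc.mul_left _).integrableOn hD ((contDiffOn_const.mul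
      (contDiffOn_iteratedDeriv hD (hug j hj) j)).mul hψ).continuousOn
  have h1 : theta D x t' (fun τ => diffDist k g τ ψ) = ∑ j ∈ Finset.range (k + 2),
      ∫ t in D ∩ Iic t', x t' t * g j t * iteratedDeriv j ψ t := by
    rw [← integral_finsetSum _ hI]
    simp only [theta, diffDist_apply, Finset.mul_sum, mul_assoc]
  have h2 : theta D (rReg k g x) t' ψ = ∑ j ∈ Finset.range (k + 2),
      ∫ t in D ∩ Iic t', (-1) ^ j * iteratedDeriv j (fun s => x t' s * g j s) t * ψ t := by
    rw [← integral_finsetSum _ hI']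
    simp only [theta, rReg, Finset.sum_mul]
  have h3 : invDist D k g x t' ψ = theta D (rReg k g x) t' ψ +
      ∑ m ∈ Finset.range (k + 1), rSing k g x m t' * iteratedDeriv m ψ t' := by
    simp [invDist, lmul, delta, Finset.sum_apply]
  rw [h1, h3, h2, Finset.sum_congr rfl fun j hj =>
    hψc.integral_mul_iteratedDeriv hD ht' hψ (hug j hj) j, Finset.sum_add_distrib, add_comm]
  congr 1
  simp only [rSing, Finset.sum_mul]
  rw [Finset.sum_comm' (s := Finset.range (k + 1)) (t' := Finset.range (k + 2)) (s' := fun j => Finset.range j)]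
  · refine Finset.sum_congr rfl fun j _ => ?_
    rw [← Finset.sum_range_reflect]
    refine Finset.sum_congr rfl fun s hs => ?_
    rw [show j - 1 - (j - 1 - s) = s by have := Finset.mem_range.1 hs; omega]
  · intro m j
    simp only [Finset.mem_range, Finset.mem_Icc]
    omega

/-- The coefficients of `δ^{(m)}` in `x ∗ L` are smooth. -/
theorem contDiffOn_rSing (hk : 0 < k) (hD : IsOpen D) {h : ℕ → ℝ → 𝕜}
    (hh : ∀ m ≤ k, ContDiffOn ℝ ∞ (h m) D) (hh0 : ∀ t ∈ D, h k t ≠ 0)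
    (hg : ∀ j ≤ k + 1, ContDiffOn ℝ ∞ (g j) D) {x : ℝ → ℝ → 𝕜} (hx : IsSolution D k h x)
    (m : ℕ) : ContDiffOn ℝ ∞ (rSing k g x m) D := by
  have hlow : ∀ i < k, ContDiffOn ℝ ∞ (fun t => iteratedDeriv i (x t) t) D := fun i hi => by
    rcases (Nat.le_sub_one_of_lt hi).eq_or_lt with rfl | hi'
    · exact ((hh k le_rfl).inv hh0).neg.congr fun t ht => (hx t ht).2.2.1
    · exact contDiffOn_const.congr fun t ht => (hx t ht).2.2.2 i (by omega)
  -- Joint smoothness of `x` is not assumed, but only its diagonal jet of order at most `k` matters.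
  -- Orders below `k` are prescribed, and order `k` follows by solving the equation at `t = t'`.
  have hjet : ∀ i ≤ k, ContDiffOn ℝ ∞ (fun t => iteratedDeriv i (x t) t) D := fun i hi => by
    rcases hi.eq_or_lt with rfl | hi'
    · have : ContDiffOn ℝ ∞
          (fun t => -(∑ m ∈ Finset.range i, h m t * iteratedDeriv m (x t) t) / h i t) D :=
        contDiffOn_div (ContDiffOn.sum fun m hm => (hh m (Finset.mem_range.1 hm).le).mul
          (hlow m (Finset.mem_range.1 hm))).neg (hh i le_rfl) hh0
      refine this.congr fun t ht => ?_
      have := (hx t ht).2.1 t ht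
      rw [Finset.sum_range_succ] at this
      rw [eq_div_iff (hh0 t ht), mul_comm]
      exact eq_neg_of_add_eq_zero_right this
    · exact hlow i hi'
  refine ContDiffOn.sum fun j hj => contDiffOn_const.mul ?_
  have hj' := Finset.mem_Icc.1 hj
  refine ContDiffOn.congr ?_ fun t ht => iteratedDeriv_mul_eq_sum_range hD (hx t ht).1
    (hg j hj'.2) ht (Nat.lt_succ_self _)
  exact ContDiffOn.sum fun i hi => (contDiffOn_const.mul
    (hjet i (by have := Finset.mem_range.1 hi; omega))).mul
      (contDiffOn_iteratedDeriv hD (hg j hj'.2) _)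

theorem contDiffOn_rReg (hD : IsOpen D) (hg : ∀ j ≤ k + 1, ContDiffOn ℝ ∞ (g j) D)
    {x : ℝ → ℝ → 𝕜} (hx : ContDiffOn ℝ ∞ (fun p : ℝ × ℝ => x p.1 p.2) (D ×ˢ D)) :
    ContDiffOn ℝ ∞ (fun p : ℝ × ℝ => rReg k g x p.1 p.2) (D ×ˢ D) :=
  ContDiffOn.sum fun j hj => contDiffOn_const.mul
    (contDiffOn_iteratedDeriv_right (f := fun t' s => x t' s * g j s) hD hD
      (hx.mul ((hg j (by have := Finset.mem_range.1 hj; omega)).comp contDiffOn_snd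
        fun p hp => hp.2)) j)

end StarOperator

/-! ### From left inverses to two-sided inverses -/

section Inverses

variable {𝕜 : Type*} [RCLike 𝕜] {D J : Set ℝ} {k : ℕ} {f : ℝ → ℝ → 𝕜} {g : ℕ → ℝ → 𝕜}
  {ψ φ : ℝ → 𝕜} {a t t' : ℝ}

theorem IsTest.leftCompact (hφ : IsTest D φ) (t' : ℝ) : LeftCompact D t' φ :=
  ⟨tsupport φ, hφ.2.1, hφ.2.2, fun _ _ _ ht => image_eq_zero_of_notMem_tsupport ht⟩

theorem IsTest.contDiffOn (hφ : IsTest D φ) : ContDiffOn ℝ ∞ φ D := hφ.1.contDiffOn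

theorem IsTest.exists_eq_zero (hφ : IsTest J φ) (hJ : J.Nonempty) :
    ∃ a ∈ J, ∀ t ∈ J, t < a → φ t = 0 := by
  obtain ⟨s, hs⟩ := hJ
  -- The extra point covers the case of empty support.
  have hc : IsCompact (insert s (tsupport φ)) := hφ.2.1.insert s
  obtain ⟨a, ha, hmin⟩ := hc.exists_isLeast ⟨s, mem_insert _ _⟩
  refine ⟨a, insert_subset hs hφ.2.2 ha, fun t _ hta => image_eq_zero_of_notMem_tsupport ?_⟩
  exact fun ht => (hmin (mem_insert_of_mem _ ht)).not_gt hta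

/-- Here `J` has to be an interval: `Icc a t'` must lie in `J`. The condition of vanishing left of
`a`, unlike compact support, is preserved by `f ∗ ·` and by causal solutions. -/
theorem leftCompact_of_eq_zero (hJc : J.OrdConnected) (ha : a ∈ J)
    (hψ : ∀ t ∈ J, t < a → ψ t = 0) (ht' : t' ∈ J) : LeftCompact J t' ψ :=
  ⟨Icc a t', isCompact_Icc, hJc.out ha ht', fun t ht htt h =>
    hψ t ht (not_le.1 fun hat => h ⟨hat, htt.le⟩)⟩

theorem theta_eq_zero (hψ : ∀ t ∈ J, t < a → ψ t = 0) (ht : t < a) : theta J f t ψ = 0 :=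
  setIntegral_eq_zero_of_forall_eq_zero fun s hs => by
    rw [hψ s hs.1 (lt_of_le_of_lt hs.2 ht), mul_zero]

theorem iteratedDeriv_eq_zero (hJ : IsOpen J) (hψ : ∀ t ∈ J, t < a → ψ t = 0) (ht : t ∈ J)
    (hta : t < a) (m : ℕ) : iteratedDeriv m ψ t = 0 := by
  have : ψ =ᶠ[𝓝 t] fun _ => 0 := by
    filter_upwards [hJ.mem_nhds ht, Iio_mem_nhds hta] with s h1 h2 using hψ s h1 h2
  rw [this.iteratedDeriv_eq]
  simp

/-- A solution of a homogeneous linear equation that vanishes at the left end vanishes. -/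
theorem eq_zero_of_linear_equation (hJ : IsOpen J) (hJc : J.OrdConnected) {n : ℕ}
    {p : ℕ → ℝ → 𝕜} (hp : ∀ m ≤ n + 1, ContDiffOn ℝ ∞ (p m) J) (hp0 : ∀ t ∈ J, p (n + 1) t ≠ 0)
    (hψ : ContDiffOn ℝ ∞ ψ J)
    (heq : ∀ t ∈ J, ∑ m ∈ Finset.range (n + 2), p m t * iteratedDeriv m ψ t = 0) (ha : a ∈ J)
    (hψ0 : ∀ t ∈ J, t < a → ψ t = 0) (ht : t ∈ J) : ψ t = 0 := by
  obtain ⟨b, _, hb, _, hbJ⟩ := exists_Ioo_of_mem hJ hJc ha ha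
  have hb' : b ∈ J := hbJ ⟨le_rfl, (hb.1.trans hb.2).le⟩
  exact eqOn_of_linear_equation (v := fun _ => 0) (χ := fun _ => 0) hJ hJc hb' hp hp0 hψ heq
    contDiffOn_const (fun s _ => by simp)
    (fun i _ => by simpa using iteratedDeriv_eq_zero hJ hψ0 hb' hb.1 i) ht

/-- A linear equation with causal right-hand side has a causal solution. -/
theorem exists_causal_solution (hJ : IsOpen J) (hJc : J.OrdConnected) {n : ℕ}
    {p : ℕ → ℝ → 𝕜} (hp : ∀ m ≤ n, ContDiffOn ℝ ∞ (p m) J) (hp0 : ∀ t ∈ J, p n t ≠ 0)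
    {χ : ℝ → 𝕜} (hχ : ContDiffOn ℝ ∞ χ J) (ha : a ∈ J) (hχ0 : ∀ t ∈ J, t < a → χ t = 0) :
    ∃ ψ : ℝ → 𝕜, ContDiffOn ℝ ∞ ψ J ∧ (∀ t ∈ J, t < a → ψ t = 0) ∧
      ∀ t ∈ J, ∑ m ∈ Finset.range (n + 1), p m t * iteratedDeriv m ψ t = χ t := by
  cases n with
  | zero =>
    refine ⟨fun t => χ t / p 0 t, contDiffOn_div hχ (hp 0 le_rfl) hp0,
      fun t ht hta => by simp [hχ0 t ht hta], fun t ht => ?_⟩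
    simp [mul_div_cancel₀ _ (hp0 t ht)]
  | succ n =>
    obtain ⟨b, _, hb, _, hbJ⟩ := exists_Ioo_of_mem hJ hJc ha ha
    have hb' : b ∈ J := hbJ ⟨le_rfl, (hb.1.trans hb.2).le⟩
    -- Zero data at a point `b < a`; left of `a` the equation is homogeneous, so uniqueness on `J ∩
    -- Iio a` makes `ψ` vanish there.
    obtain ⟨ψ, hψ, heq, hψ0⟩ := exists_solution_linear_equation hJ hJc hb' hp hp0 hχ 0
    have hsub : J ∩ Iio a ⊆ J := inter_subset_left
    refine ⟨ψ, hψ, fun t ht hta => ?_, heq⟩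
    exact eqOn_of_linear_equation (v := fun _ => 0) (χ := fun _ => 0) (hJ.inter isOpen_Iio)
      (hJc.inter ordConnected_Iio) ⟨hb', hb.1⟩ (fun m hm => (hp m hm).mono hsub)
      (fun s hs => hp0 s hs.1) (hψ.mono hsub)
      (fun s hs => by rw [heq s hs.1, hχ0 s hs.1 hs.2])
      contDiffOn_const (fun s _ => by simp)
      (fun i hi => by simpa using hψ0 ⟨i, by omega⟩) ⟨ht, hta⟩

/-- On causal functions on an interval, `ψ ↦ f ∗ ψ` is surjective. -/
theorem exists_theta_eq (hJ : IsOpen J) (hJc : J.OrdConnected)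
    (hf : ContDiffOn ℝ ∞ (fun p : ℝ × ℝ => f p.1 p.2) (J ×ˢ J))
    (hg : ∀ j ≤ k + 1, ContDiffOn ℝ ∞ (g j) J)
    (hL : ∀ t' ∈ J, ∀ t ∈ J,
      ∑ j ∈ Finset.range (k + 2), g j t' * iteratedDeriv j (fun s => f s t) t' = 0)
    (h0 : ∀ t ∈ J, f t t * g (k + 1) t ≠ 0) (hφ : ContDiffOn ℝ ∞ φ J) (ha : a ∈ J)
    (hφ0 : ∀ t ∈ J, t < a → φ t = 0) :
    ∃ ψ : ℝ → 𝕜, ContDiffOn ℝ ∞ ψ J ∧ (∀ t ∈ J, t < a → ψ t = 0) ∧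
      ∀ t ∈ J, theta J f t ψ = φ t := by
  -- Since `f ∗ ψ = φ` would imply `(L ∗ f) ψ = L φ`, this differential equation determines the
  -- candidate.
  obtain ⟨ψ, hψ, hψ0, heq⟩ := exists_causal_solution (p := starCoeff k f g)
    (χ := fun t => diffDist k g t φ) hJ hJc (fun m _ => contDiffOn_starCoeff hJ hf hg m)
    (fun t ht => by rw [starCoeff_top, mul_comm]; exact h0 t ht)
    (by
      simp only [diffDist_apply]
      exact ContDiffOn.sum fun j hj =>
        (hg j (by have := Finset.mem_range.1 hj; omega)).mul (contDiffOn_iteratedDeriv hJ hφ j))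
    ha (fun t ht hta => by
      rw [diffDist_apply]
      exact Finset.sum_eq_zero fun j _ => by rw [iteratedDeriv_eq_zero hJ hφ0 ht hta, mul_zero])
  have hψc : ∀ t' ∈ J, LeftCompact J t' ψ := fun t' ht' =>
    leftCompact_of_eq_zero hJc ha hψ0 ht'
  have hθ : ContDiffOn ℝ ∞ (fun t => theta J f t ψ) J := contDiffOn_volterra hJ hψ hψc hf
  refine ⟨ψ, hψ, hψ0, fun t ht => sub_eq_zero.1 ?_⟩
  -- Conversely, `f ∗ ψ - φ` is annihilated by `L` and vanishes left of `a`; the leading coefficient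
  -- of `L` has no zero.
  refine eq_zero_of_linear_equation (ψ := fun t => theta J f t ψ - φ t) (p := g) hJ hJc hg
    (fun s hs => right_ne_zero_of_mul (h0 s hs)) (hθ.sub hφ) (fun s hs => ?_) ha
    (fun s hs hsa => by rw [theta_eq_zero hψ0 hsa, hφ0 s hs hsa, sub_zero]) ht
  have h1 := diffDist_theta hJ hf hL hψ hψc hs
  rw [starOp_eq_sum hJ hf hψ hs, heq s hs, diffDist_apply, diffDist_apply] at h1
  simp only [iteratedDeriv_fun_sub (contDiffAt_of_mem hJ hθ hs _) (contDiffAt_of_mem hJ hφ hs _),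
    mul_sub, Finset.sum_sub_distrib]
  exact sub_eq_zero.2 h1

/-- A left inverse of `f` on causal functions, if it is local, is a two-sided inverse. -/
theorem isStarInverse_of_left_inverse (hJ : IsOpen J) (hJc : J.OrdConnected)
    (hf : ContDiffOn ℝ ∞ (fun p : ℝ × ℝ => f p.1 p.2) (J ×ˢ J))
    (hg : ∀ j ≤ k + 1, ContDiffOn ℝ ∞ (g j) J)
    (hL : ∀ t' ∈ J, ∀ t ∈ J,
      ∑ j ∈ Finset.range (k + 2), g j t' * iteratedDeriv j (fun s => f s t) t' = 0)
    (h0 : ∀ t ∈ J, f t t * g (k + 1) t ≠ 0) {R : GenFun 𝕜}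
    (hloc : ∀ t ∈ J, ∀ φ₁ φ₂ : ℝ → 𝕜, Set.EqOn φ₁ φ₂ J → R t φ₁ = R t φ₂)
    (hR : ∀ t ∈ J, ∀ ψ : ℝ → 𝕜, ContDiffOn ℝ ∞ ψ J → (∃ a ∈ J, ∀ s ∈ J, s < a → ψ s = 0) →
      R t (fun τ => theta J f τ ψ) = ψ t) :
    IsStarInverse J (theta J f) R := by
  refine ⟨fun t' ht' φ hφ => ?_, fun t' ht' φ hφ => ?_⟩
  · simpa [star, delta] using hR t' ht' φ hφ.contDiffOn (hφ.exists_eq_zero ⟨t', ht'⟩)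
  · obtain ⟨a, ha, hφ0⟩ := hφ.exists_eq_zero ⟨t', ht'⟩
    obtain ⟨ψ, hψ, hψ0, hθ⟩ := exists_theta_eq hJ hJc hf hg hL h0 hφ.contDiffOn ha hφ0
    -- `f ∗ ψ` and `φ` agree only on `J`; locality of `R` makes that enough.
    have hRφ : ∀ τ ∈ J, R τ φ = ψ τ := fun τ hτ =>
      (hloc τ hτ _ _ fun s hs => (hθ s hs).symm).trans (hR τ hτ ψ hψ ⟨a, ha, hψ0⟩)
    simp only [star, delta, iteratedDeriv_zero]
    rw [← hθ t' ht']
    exact setIntegral_congr_fun (hJ.measurableSet.inter measurableSet_Iic) fun τ hτ => by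
      simp only [hRφ τ hτ.1]

theorem diffDist_congr (hJ : IsOpen J) (ht : t ∈ J) (h : Set.EqOn φ ψ J) :
    diffDist k g t φ = diffDist k g t ψ := by
  simp only [diffDist_apply]
  exact Finset.sum_congr rfl fun j _ => by rw [h.iteratedDeriv_of_isOpen hJ j ht]

theorem invDist_congr {x : ℝ → ℝ → 𝕜} (hJ : IsOpen J) (ht : t ∈ J) (h : Set.EqOn φ ψ J) :
    invDist J k g x t φ = invDist J k g x t ψ := by
  have h1 : theta J (rReg k g x) t φ = theta J (rReg k g x) t ψ :=
    setIntegral_congr_fun (hJ.measurableSet.inter measurableSet_Iic) fun τ hτ => by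
      simp only [h hτ.1]
  simp only [invDist, Pi.add_apply, h1, Finset.sum_apply, lmul, delta]
  congr 1
  exact Finset.sum_congr rfl fun m _ => by rw [h.iteratedDeriv_of_isOpen hJ m ht]

/-- `x ∗ (L ∗ f) = δ` on functions with left-compact support. -/
theorem theta_diffDist_theta (hk : 0 < k) (hD : IsOpen D)
    (hf : ContDiffOn ℝ ∞ (fun p : ℝ × ℝ => f p.1 p.2) (D ×ˢ D))
    (hg : ∀ j ≤ k + 1, ContDiffOn ℝ ∞ (g j) D)
    (hL : ∀ t' ∈ D, ∀ t ∈ D,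
      ∑ j ∈ Finset.range (k + 2), g j t' * iteratedDeriv j (fun s => f s t) t' = 0)
    (h0 : ∀ t ∈ D, f t t * g (k + 1) t ≠ 0)
    {x : ℝ → ℝ → 𝕜} (hx : IsSolution D k (hCoeff k f g) x)
    (hψ : ContDiffOn ℝ ∞ ψ D) (hψc : ∀ t' ∈ D, LeftCompact D t' ψ) (ht' : t' ∈ D) :
    theta D x t' (fun τ => diffDist k g τ fun s => theta D f s ψ) = ψ t' := by
  rw [← integral_mul_starOp hk hD hf hg ht' (h0 t' ht') hx hψ (hψc t' ht')]
  exact setIntegral_congr_fun (hD.measurableSet.inter measurableSet_Iic) fun τ hτ => by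
    simp only [diffDist_theta hD hf hL hψ hψc hτ.1]

/-- Replacing `x ∗ L` by its normal form on `f ∗ ψ` requires `f ∗ ψ` to be left-compact. On an
interval this holds because it vanishes left of `a`; on a disconnected set it can fail. -/
theorem isStarInverse_invDist (hk : 0 < k) (hJ : IsOpen J) (hJc : J.OrdConnected)
    (hf : ContDiffOn ℝ ∞ (fun p : ℝ × ℝ => f p.1 p.2) (J ×ˢ J))
    (hg : ∀ j ≤ k + 1, ContDiffOn ℝ ∞ (g j) J)
    (hL : ∀ t' ∈ J, ∀ t ∈ J,
      ∑ j ∈ Finset.range (k + 2), g j t' * iteratedDeriv j (fun s => f s t) t' = 0)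
    (h0 : ∀ t ∈ J, f t t * g (k + 1) t ≠ 0)
    {x : ℝ → ℝ → 𝕜} (hx : IsSolution J k (hCoeff k f g) x) :
    IsStarInverse J (theta J f) (invDist J k g x) := by
  refine isStarInverse_of_left_inverse hJ hJc hf hg hL h0
    (fun t ht _ _ h => invDist_congr hJ ht h) fun t ht ψ hψ ⟨a, ha, hψ0⟩ => ?_
  have hψc : ∀ t' ∈ J, LeftCompact J t' ψ := fun t' ht' =>
    leftCompact_of_eq_zero hJc ha hψ0 ht'
  have hθ : ContDiffOn ℝ ∞ (fun τ => theta J f τ ψ) J := contDiffOn_volterra hJ hψ hψc hf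
  rw [← theta_diffDist hJ hg ht (hx t ht).1 hθ
    (leftCompact_of_eq_zero hJc ha (fun s _ hs => theta_eq_zero hψ0 hs) ht)]
  exact theta_diffDist_theta hk hJ hf hg hL h0 hx hψ hψc ht

/-- For `k = 0`, dividing `L` by the leading coefficient of `L ∗ f` gives a left inverse. -/
theorem lmul_diffDist_theta (hD : IsOpen D)
    (hf : ContDiffOn ℝ ∞ (fun p : ℝ × ℝ => f p.1 p.2) (D ×ˢ D))
    (hL : ∀ t' ∈ D, ∀ t ∈ D,
      ∑ j ∈ Finset.range (0 + 2), g j t' * iteratedDeriv j (fun s => f s t) t' = 0)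
    (h0 : ∀ t ∈ D, f t t * g (0 + 1) t ≠ 0)
    (hψ : ContDiffOn ℝ ∞ ψ D) (hψc : ∀ t' ∈ D, LeftCompact D t' ψ) (ht : t ∈ D) :
    lmul (fun t' => (g 1 t' * f t' t')⁻¹) (diffDist 0 g) t (fun s => theta D f s ψ) = ψ t := by
  have h1 : g 1 t * f t t ≠ 0 := by
    rw [mul_comm]
    exact h0 t ht
  rw [lmul, diffDist_theta hD hf hL hψ hψc ht, starOp_eq_sum hD hf hψ ht]
  simp only [zero_add, Finset.sum_range_one, starCoeff_top, iteratedDeriv_zero]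
  exact inv_mul_cancel_left₀ h1 _

/-! ### Size of the set of regular points -/

section RegularSet

variable {I : Set ℝ}

theorem isOpen_regularSet (hf : ContDiffOn ℝ ∞ (fun p : ℝ × ℝ => f p.1 p.2) (I ×ˢ I))
    (hg : ContDiffOn ℝ ∞ (g (k + 1)) I) : IsOpen (regularSet I k f g) :=
  (((contDiffOn_diag hf).mul hg).continuousOn.mono interior_subset).isOpen_inter_preimage
    isOpen_interior isOpen_compl_singleton

theorem regularSet_nonempty (hI : I.OrdConnected) (hI' : I.Nontrivial)
    (hf : ContDiffOn ℝ ∞ (fun p : ℝ × ℝ => f p.1 p.2) (I ×ˢ I)) (hf0 : ∃ t ∈ I, f t t ≠ 0)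
    (hg0 : ∀ t ∈ I, g (k + 1) t ≠ 0) : (regularSet I k f g).Nonempty := by
  obtain ⟨t, ht, hft⟩ := hf0
  have hint : (interior I).Nonempty := by
    obtain ⟨a, ha, b, hb, hab⟩ := hI'.exists_lt
    exact (nonempty_Ioo.2 hab).mono
      (interior_maximal (Ioo_subset_Icc_self.trans (hI.out ha hb)) isOpen_Ioo)
  -- The point with `f t t ≠ 0` may be an endpoint of `I`; by continuity an interior point nearby
  -- serves.
  have hcl : t ∈ closure (interior I) := by
    rw [(convex_iff_ordConnected.2 hI).closure_interior_eq_closure_of_nonempty_interior hint]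
    exact subset_closure ht
  have hev : ∀ᶠ s in 𝓝[interior I] t, f s s ≠ 0 :=
    (((contDiffOn_diag hf).continuousOn t ht).mono interior_subset).eventually_ne hft
  have := mem_closure_iff_nhdsWithin_neBot.1 hcl
  obtain ⟨s, hs, hsI⟩ := (hev.and self_mem_nhdsWithin).exists
  exact ⟨s, hsI, mul_ne_zero hs (hg0 s (interior_subset hsI))⟩

theorem volume_prod_sdiff_regularSet (hI : I.OrdConnected)
    (h : volume {t | t ∈ I ∧ f t t * g (k + 1) t = 0} = 0) :
    volume ((I ×ˢ I) \ (regularSet I k f g ×ˢ regularSet I k f g)) = 0 := by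
  have h1 : volume (I \ regularSet I k f g) = 0 := by
    refine measure_mono_null (t := {t | t ∈ I ∧ f t t * g (k + 1) t = 0} ∪ frontier I) ?_
      (measure_union_null h ((convex_iff_ordConnected.2 hI).addHaar_frontier volume))
    rintro t ⟨ht, htU⟩
    by_cases hti : t ∈ interior I
    · exact Or.inl ⟨ht, not_not.1 fun h0 => htU ⟨hti, h0⟩⟩
    · exact Or.inr ⟨subset_closure ht, hti⟩
  refine measure_mono_null (t := (I \ regularSet I k f g) ×ˢ univ ∪
    univ ×ˢ (I \ regularSet I k f g)) ?_ (measure_union_null ?_ ?_)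
  · rintro ⟨s, t⟩ ⟨⟨hs, ht⟩, hst⟩
    by_cases hsU : s ∈ regularSet I k f g
    · exact Or.inr ⟨trivial, ht, fun htU => hst ⟨hsU, htU⟩⟩
    · exact Or.inl ⟨⟨hs, hsU⟩, trivial⟩
  · rw [Measure.volume_eq_prod, Measure.prod_prod, h1, zero_mul]
  · rw [Measure.volume_eq_prod, Measure.prod_prod, h1, mul_zero]

end RegularSet

end Inverses

end StarInv

/-! ### The theorem -/

theorem theorem2p1 {𝕜 : Type*} [RCLike 𝕜] (I : Set ℝ) (hI : I.OrdConnected)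
    (hI' : I.Nontrivial) (k : ℕ) (f : ℝ → ℝ → 𝕜) (g : ℕ → ℝ → 𝕜)
    (hf : ContDiffOn ℝ ∞ (fun p : ℝ × ℝ => f p.1 p.2) (I ×ˢ I))
    (hf0 : ∃ t ∈ I, f t t ≠ 0)
    (hg : ∀ j ≤ k + 1, ContDiffOn ℝ ∞ (g j) I)
    (hg0 : ∃ t ∈ I, g (k + 1) t ≠ 0)
    (hL : ∀ t' ∈ interior I, ∀ t ∈ interior I,
      ∑ j ∈ Finset.range (k + 2), g j t' * iteratedDeriv j (fun s => f s t) t' = 0)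
    (U : Set ℝ) (hU : U = StarInv.regularSet I k f g) :
    -- size of the set of regular points
    IsOpen U ∧
    ((∀ t ∈ I, g (k + 1) t ≠ 0) → U.Nonempty) ∧
    (MeasureTheory.volume {t | t ∈ I ∧ f t t * g (k + 1) t = 0} = 0 →
      MeasureTheory.volume ((I ×ˢ I) \ (U ×ˢ U)) = 0) ∧
    -- the case `k > 0`
    (0 < k →
      (∀ m ≤ k, ContDiffOn ℝ ∞ (StarInv.hCoeff k f g m) (interior I)) ∧
      (∃ x : ℝ → ℝ → 𝕜, StarInv.IsSolution U k (StarInv.hCoeff k f g) x ∧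
        ContDiffOn ℝ ∞ (fun p : ℝ × ℝ => x p.1 p.2) (U ×ˢ U)) ∧
      ∀ x : ℝ → ℝ → 𝕜, StarInv.IsSolution U k (StarInv.hCoeff k f g) x →
        StarInv.EqOn U (StarInv.star (StarInv.theta U x) (StarInv.diffDist k g))
          (StarInv.invDist U k g x) ∧
        StarInv.EqOn U (StarInv.star (StarInv.theta U x)
            (StarInv.star (StarInv.diffDist k g) (StarInv.theta U f)))
          (StarInv.delta 0) ∧
        (∀ m ≤ k, ContDiffOn ℝ ∞ (StarInv.rSing k g x m) U) ∧
        ∀ J ⊆ U, IsOpen J → J.OrdConnected →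
          (∀ y : ℝ → ℝ → 𝕜, StarInv.IsSolution J k (StarInv.hCoeff k f g) y →
            ∀ t' ∈ J, ∀ t ∈ J, y t' t = x t' t) ∧
          ContDiffOn ℝ ∞ (fun p : ℝ × ℝ => x p.1 p.2) (J ×ˢ J) ∧
          ContDiffOn ℝ ∞ (fun p : ℝ × ℝ => StarInv.rReg k g x p.1 p.2) (J ×ˢ J) ∧
          StarInv.EqOn J (StarInv.star (StarInv.theta J x) (StarInv.diffDist k g))
            (StarInv.invDist J k g x) ∧
          StarInv.IsStarInverse J (StarInv.theta J f) (StarInv.invDist J k g x)) ∧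
    -- the case `k = 0`
    (k = 0 →
      StarInv.EqOn U
        (StarInv.star (StarInv.lmul (fun t' => (g 1 t' * f t' t')⁻¹) (StarInv.diffDist k g))
          (StarInv.theta U f))
        (StarInv.delta 0) ∧
      ∀ J ⊆ U, IsOpen J → J.OrdConnected →
        StarInv.IsStarInverse J (StarInv.theta J f)
          (StarInv.lmul (fun t' => (g 1 t' * f t' t')⁻¹) (StarInv.diffDist k g))) := by
  subst hU
  set U := StarInv.regularSet I k f g with hUdef
  have hUo : IsOpen U := StarInv.isOpen_regularSet hf (hg _ le_rfl)
  have hUV : U ⊆ interior I := fun t ht => ht.1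
  have hUI : U ⊆ I := hUV.trans interior_subset
  have hfD : ∀ D ⊆ I, ContDiffOn ℝ ∞ (fun p : ℝ × ℝ => f p.1 p.2) (D ×ˢ D) := fun D hD =>
    hf.mono (Set.prod_mono hD hD)
  have hgD : ∀ D ⊆ I, ∀ j ≤ k + 1, ContDiffOn ℝ ∞ (g j) D := fun D hD j hj => (hg j hj).mono hD
  have hLD : ∀ D ⊆ U, ∀ t' ∈ D, ∀ t ∈ D,
      ∑ j ∈ Finset.range (k + 2), g j t' * iteratedDeriv j (fun s => f s t) t' = 0 :=
    fun D hD t' ht' t ht => hL t' (hUV (hD ht')) t (hUV (hD ht))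
  have h0 : ∀ D ⊆ U, ∀ t ∈ D, f t t * g (k + 1) t ≠ 0 := fun D hD t ht => (hD ht).2
  refine ⟨hUo, StarInv.regularSet_nonempty hI hI' hf hf0,
    StarInv.volume_prod_sdiff_regularSet hI, fun hk => ?_, fun hk => ?_⟩
  · have hh : ∀ m ≤ k, ContDiffOn ℝ ∞ (StarInv.hCoeff k f g m) (interior I) := fun m _ =>
      StarInv.contDiffOn_hCoeff isOpen_interior (hfD _ interior_subset) (hgD _ interior_subset) m
    have hhD : ∀ D ⊆ U, ∀ m ≤ k, ContDiffOn ℝ ∞ (StarInv.hCoeff k f g m) D := fun D hD m hm =>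
      (hh m hm).mono (hD.trans hUV)
    have hh0 : ∀ D ⊆ U, ∀ t ∈ D, StarInv.hCoeff k f g k t ≠ 0 := fun D hD t ht => by
      rw [StarInv.hCoeff_top, mul_assoc]
      exact mul_ne_zero (pow_ne_zero _ (neg_ne_zero.2 one_ne_zero)) (h0 D hD t ht)
    obtain ⟨x₀, hx₀, hx₀s⟩ :=
      StarInv.exists_isSolution hk hUo (hhD U subset_rfl) (hh0 U subset_rfl)
    refine ⟨hh, ⟨x₀, hx₀, hx₀s⟩, fun x hx => ⟨fun t' ht' φ hφ => ?_, fun t' ht' φ hφ => ?_,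
      fun m _ => StarInv.contDiffOn_rSing hk hUo (hhD U subset_rfl) (hh0 U subset_rfl)
        (hgD U hUI) hx m, fun J hJU hJ hJc => ?_⟩⟩
    · exact StarInv.theta_diffDist hUo (hgD U hUI) ht' (hx t' ht').1 hφ.contDiffOn
        (hφ.leftCompact t')
    · simp only [StarInv.star, StarInv.delta, iteratedDeriv_zero]
      exact StarInv.theta_diffDist_theta hk hUo (hfD U hUI) (hgD U hUI)
        (hLD U subset_rfl) (h0 U subset_rfl) hx hφ.contDiffOn (fun s _ => hφ.leftCompact s) ht'
    · have hJI := hJU.trans hUI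
      have huniq : ∀ y : ℝ → ℝ → 𝕜, StarInv.IsSolution J k (StarInv.hCoeff k f g) y →
          ∀ t' ∈ J, ∀ t ∈ J, y t' t = x t' t := fun y hy t' ht' t ht =>
        hy.unique hk hJ hJc (hhD J hJU) (hh0 J hJU) (hx.mono hJU) ht' ht
      -- `x` is assumed smooth in `t` only; on `J` uniqueness identifies it with the jointly smooth
      -- solution `x₀`.
      have hxs : ContDiffOn ℝ ∞ (fun p : ℝ × ℝ => x p.1 p.2) (J ×ˢ J) :=
        (hx₀s.mono (Set.prod_mono hJU hJU)).congr fun p hp =>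
          (huniq x₀ (hx₀.mono hJU) p.1 hp.1 p.2 hp.2).symm
      exact ⟨huniq, hxs, StarInv.contDiffOn_rReg hJ (hgD J hJI) hxs,
        fun t' ht' φ hφ => StarInv.theta_diffDist hJ (hgD J hJI) ht' (hx.mono hJU t' ht').1
          hφ.contDiffOn (hφ.leftCompact t'),
        StarInv.isStarInverse_invDist hk hJ hJc (hfD J hJI) (hgD J hJI) (hLD J hJU) (h0 J hJU)
          (hx.mono hJU)⟩
  · subst hk
    refine ⟨fun t' ht' φ hφ => ?_, fun J hJU hJ hJc => ?_⟩
    · simp only [StarInv.star, StarInv.delta, iteratedDeriv_zero]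
      exact StarInv.lmul_diffDist_theta hUo (hfD U hUI)
        (hLD U subset_rfl) (h0 U subset_rfl) hφ.contDiffOn (fun s _ => hφ.leftCompact s) ht'
    · have hJI := hJU.trans hUI
      refine StarInv.isStarInverse_of_left_inverse hJ hJc (hfD J hJI) (hgD J hJI) (hLD J hJU)
        (h0 J hJU) (fun t ht φ₁ φ₂ h => ?_) fun t ht ψ hψ ⟨a, ha, hψ0⟩ => ?_
      · simp only [StarInv.lmul, StarInv.diffDist_congr hJ ht h]
      · exact StarInv.lmul_diffDist_theta hJ (hfD J hJI) (hLD J hJU) (h0 J hJU) hψ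
          (fun t' ht' => StarInv.leftCompact_of_eq_zero hJc ha hψ0 ht') ht
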